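/- Let $\mathfrak M(3)$ be the set of pairs $(A,B)$ of invertible complex $3\times3$ matrices modulo simultaneous conjugation. An automorphism $c_1\mapsto w_1(c_1,c_2)$, $c_2\mapsto w_2(c_1,c_2)$ of the free group $F_2=\langle c_1,c_2\rangle$ sends the class of $(A,B)$ to the class of $(w_1(A,B),w_2(A,B))$; this gives an action of $\mathrm{Out}(F_2)$ on $\mathfrak M(3)$, and $\sigma:\mathrm{Out}(F_2)\to\mathrm{GL}(2,\mathbb Z)$ sends an automorphism to the matrix whose rows are the exponent sums of $w_1$ and $w_2$. Through $\sigma$ one speaks of the action of $\mathrm{GL}(2,\mathbb Z)$ on $\mathfrak M(3)$. Spectral data. The spectral curve of $(A,B)$ is the plane cubic $\mathfrak C\subset\mathbb{CP}^2$ with equation $F_{A,B}(\lambda,\mu,\nu)=\det(\lambda+\mu A+\nu B)=0$. Suppose that $A$ has distinct eigenvalues, put in an order $h_1,h_2,h_3$, let $U=(u_{ij})$ be the matrix of $B$ in a corresponding eigenbasis of $A$, and suppose $u_{12}\ne0$, $u_{13}\ne 0$. The distinguished point of $(A,B)$ is $Q=(L:M:1)$, where $$L=\frac{u_{12}h_3(u_{12}u_{23}-u_{13}u_{22})+u_{13}h_2(u_{12}u_{33}-u_{13}u_{32})}{u_{13}u_{12}(h_3-h_2)},\qquad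 M=-\frac{u_{12}(u_{12}u_{23}-u_{13}u_{22})+u_{13}(u_{12}u_{33}-u_{13}u_{32})}{u_{13}u_{12}(h_3-h_2)}.$$ Proposition. Let $\tau\in\mathrm{Out}(F_2)$ be the class of the automorphism $(c_1,c_2)\mapsto(c_2,c_1)$. Then $\sigma(\tau)=\begin{pmatrix}0&1\\1&0\end{pmatrix}$, and $\tau$ sends the class of $(A,B)$ to the class of $(B,A)$. Let $(A',B')$ be any pair in the image under $\tau$ of the class of $(A,B)$. Suppose that $\mathfrak C$ is nonsingular, that $(A,B)$ with ordered eigenvalues $h_1,h_2,h_3$ of $A$, and $(A',B')$ with ordered eigenvalues $\xi_1,\xi_2,\xi_3$ of $A'$ (these are the eigenvalues of $B$), satisfy the conditions in the definition of the distinguished point, and let $Q$ be the distinguished point of $(A,B)$. Put $P_i=(h_i:-1:0)$ and $X_i=(\xi_i:0:-1)$. Then: 1. $F_{A',B'}(\lambda,\mu,\nu)=F_{A,B}(\lambda,\nu,\mu)$, that is, $\mu$ and $\nu$ are transposed in the equation of the cubic. 2. Let $\ell_1=0$ be the line $X_1Q$ and $T$ its third point of intersection with $\mathfrak C$; let $\ell_2=0$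 be the line $P_1T$ and $Y$ its third point of intersection with $\mathfrak C$. (Intersections are counted with multiplicity; the line through two coinciding points of $\mathfrak C$ is the tangent.) The points $T$ and $Y$ exist and are unique, and the distinguished point of $(A',B')$ is the image of $Y$ under $\lambda:\mu:\nu\mapsto\lambda:\nu:\mu$. 3. The restriction to $\mathfrak C$ of the function $\dfrac{\mu}{\nu}\cdot\dfrac{\ell_2}{\ell_1}$ has the divisor $X_2+X_3+Y-P_2-P_3-Q$. In particular the divisors $P_2+P_3+Q$ and $X_2+X_3+Y$ on $\mathfrak C$ are linearly equivalent. -/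

import Mathlib

open MvPolynomial Matrix

noncomputable section

/-! ### Pairs of matrices and the action of the outer automorphisms of the free group -/

/-- The free group on two generators `c₁ = of 0`, `c₂ = of 1`. -/
abbrev F2 : Type := FreeGroup (Fin 2)

/-- Pairs `(A, B)` of nondegenerate complex matrices of order `3`. -/
abbrev MatPair : Type := GL (Fin 3) ℂ × GL (Fin 3) ℂ

/-- Simultaneous conjugation `(A, B) ∼ (g A g⁻¹, g B g⁻¹)`. -/
instance conjSetoid : Setoid MatPair where
  r p q := ∃ g : GL (Fin 3) ℂ, g * p.1 * g⁻¹ = q.1 ∧ g * p.2 * g⁻¹ = q.2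
  iseqv :=
    { refl := fun p => ⟨1, by simp⟩
      symm := by
        rintro p q ⟨g, h1, h2⟩
        exact ⟨g⁻¹, by rw [← h1]; group, by rw [← h2]; group⟩
      trans := by
        rintro p q r ⟨g, h1, h2⟩ ⟨k, h3, h4⟩
        exact ⟨k * g, by rw [← h3, ← h1]; group, by rw [← h4, ← h2]; group⟩ }

/-- The space `𝔐(3)` of pairs of matrices up to simultaneous conjugation. -/
abbrev ModuliM : Type := Quotient conjSetoid

/-- The homomorphism `F₂ → GL(3, ℂ)`, `c₁ ↦ A`, `c₂ ↦ B`. -/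
def pairRep (p : MatPair) : F2 →* GL (Fin 3) ℂ := FreeGroup.lift ![p.1, p.2]

/-- An automorphism `c₁ ↦ w₁(c₁, c₂)`, `c₂ ↦ w₂(c₁, c₂)` sends `(A, B)` to
`(w₁(A, B), w₂(A, B))`. -/
def autActPair (φ : MulAut F2) (p : MatPair) : MatPair :=
  (pairRep p (φ (FreeGroup.of 0)), pairRep p (φ (FreeGroup.of 1)))

theorem pairRep_conj (p q : MatPair) (g : GL (Fin 3) ℂ)
    (h1 : g * p.1 * g⁻¹ = q.1) (h2 : g * p.2 * g⁻¹ = q.2) (w : F2) :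
    pairRep q w = g * pairRep p w * g⁻¹ := by
  have key : pairRep q = (MulAut.conj g).toMonoidHom.comp (pairRep p) := by
    apply FreeGroup.ext_hom
    intro i
    fin_cases i
    · simp [pairRep, ← h1]
    · simp [pairRep, ← h2]
  rw [key]
  simp

/-- The group of outer automorphisms `Out(F₂) = Aut(F₂) / F₂`, where `F₂` acts on itself by inner
automorphisms. -/
abbrev OutF2 : Type := MulAut F2 ⧸ (MulAut.conj : F2 →* MulAut F2).range

/-- The action of `Out(F₂)` on `𝔐(3)`. -/
def outAct (θ : OutF2) (m : ModuliM) : ModuliM :=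
  Quotient.liftOn θ
    (fun φ => Quotient.map (autActPair φ)
      (by
        rintro p q ⟨g, h1, h2⟩
        exact ⟨g, (pairRep_conj p q g h1 h2 _).symm, (pairRep_conj p q g h1 h2 _).symm⟩) m)
    (by
      intro φ ψ hφψ
      obtain ⟨w, hw⟩ := QuotientGroup.leftRel_apply.mp hφψ
      have hψ : ψ = φ * MulAut.conj w := by rw [hw]; group
      induction m using Quotient.inductionOn with
      | h p =>
        refine Quotient.sound ⟨pairRep p (φ w), ?_, ?_⟩ <;>
          simp [hψ, autActPair])

/-- The exponent sum of the generator `c_j` in a word. -/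
def exponentSum (j : Fin 2) : F2 →* Multiplicative ℤ :=
  FreeGroup.lift fun i => Multiplicative.ofAdd (if i = j then 1 else 0)

/-- The matrix of an automorphism on `F₂/[F₂, F₂] = ℤ ⊕ ℤ`: its rows are the exponent sums of
the images of `c₁` and of `c₂`. -/
def exponentMatrix (φ : MulAut F2) : Matrix (Fin 2) (Fin 2) ℤ :=
  Matrix.of fun i j => Multiplicative.toAdd (exponentSum j (φ (FreeGroup.of i)))

theorem exponentSum_apply (φ : MulAut F2) (j : Fin 2) (w : F2) :
    Multiplicative.toAdd (exponentSum j (φ w)) =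
      ∑ k, Multiplicative.toAdd (exponentSum k w) * exponentMatrix φ k j := by
  induction w using FreeGroup.induction_on with
  | C1 => simp
  | of i => fin_cases i <;> simp [exponentMatrix, exponentSum]
  | inv_of i h =>
    simp only [map_inv, toAdd_inv, neg_mul, Finset.sum_neg_distrib] at h ⊢
    rw [h]
  | mul x y hx hy =>
    simp only [map_mul, toAdd_mul, add_mul, Finset.sum_add_distrib] at hx hy ⊢
    rw [hx, hy]

theorem exponentMatrix_mul (φ ψ : MulAut F2) :
    exponentMatrix (φ * ψ) = exponentMatrix ψ * exponentMatrix φ := by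
  ext i j
  rw [Matrix.mul_apply]
  exact exponentSum_apply φ j (ψ (FreeGroup.of i))

theorem exponentMatrix_one : exponentMatrix 1 = 1 := by
  ext i j
  fin_cases i <;> fin_cases j <;> simp [exponentMatrix, exponentSum]

theorem exponentMatrix_conj (w : F2) : exponentMatrix (MulAut.conj w) = 1 := by
  rw [← exponentMatrix_one]
  ext i j
  simp [exponentMatrix]

/-- The matrix of an automorphism as an element of `GL(2, ℤ)`. -/
def autMatrix (φ : MulAut F2) : GL (Fin 2) ℤ where
  val := exponentMatrix φ
  inv := exponentMatrix φ⁻¹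
  val_inv := by rw [← exponentMatrix_mul, inv_mul_cancel, exponentMatrix_one]
  inv_val := by rw [← exponentMatrix_mul, mul_inv_cancel, exponentMatrix_one]

/-- The map `σ : Out(F₂) → GL(2, ℤ)`. -/
def sigma (θ : OutF2) : GL (Fin 2) ℤ :=
  Quotient.liftOn θ autMatrix
    (by
      intro φ ψ hφψ
      obtain ⟨w, hw⟩ := QuotientGroup.leftRel_apply.mp hφψ
      have hψ : ψ = φ * MulAut.conj w := by rw [hw]; group
      apply Units.ext
      change exponentMatrix φ = exponentMatrix ψ
      rw [hψ, exponentMatrix_mul, exponentMatrix_conj, one_mul])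

/-- The outer automorphism given by the transposition `(c₁, c₂) ↦ (c₂, c₁)`. -/
def transposition : OutF2 :=
  QuotientGroup.mk (FreeGroup.freeGroupCongr (Equiv.swap (0 : Fin 2) 1) : MulAut F2)

/-! ### The spectral cubic -/

/-- The projective plane with homogeneous coordinates `λ : μ : ν`. -/
abbrev PlanePt : Type := Projectivization ℂ (Fin 3 → ℂ)

/-- The form `det (λ + μ A + ν B)`, where `λ = X 0`, `μ = X 1`, `ν = X 2`. -/
def spectralCubic (A B : Matrix (Fin 3) (Fin 3) ℂ) : MvPolynomial (Fin 3) ℂ :=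
  ((X 0 : MvPolynomial (Fin 3) ℂ) • (1 : Matrix (Fin 3) (Fin 3) (MvPolynomial (Fin 3) ℂ))
    + (X 1 : MvPolynomial (Fin 3) ℂ) • A.map C + (X 2 : MvPolynomial (Fin 3) ℂ) • B.map C).det

/-- The form `F` vanishes at the point `p` (for homogeneous `F` the choice of homogeneous
coordinates of `p` does not matter). -/
def VanishesAt (F : MvPolynomial (Fin 3) ℂ) (p : PlanePt) : Prop := eval p.rep F = 0

/-- The curve `F = 0` is nonsingular. -/
def IsNonsingular (F : MvPolynomial (Fin 3) ℂ) : Prop :=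
  ∀ p : PlanePt, VanishesAt F p → ∃ i, eval p.rep (pderiv i F) ≠ 0

/-- The transposition `λ : μ : ν ↦ λ : ν : μ` of the plane. -/
def swapPoint : PlanePt → PlanePt :=
  Projectivization.map
    (LinearEquiv.funCongrLeft ℂ ℂ (Equiv.swap (1 : Fin 3) 2)).toLinearMap
    (LinearEquiv.funCongrLeft ℂ ℂ (Equiv.swap (1 : Fin 3) 2)).injective

/-- The transposition of `μ` and `ν` in a polynomial. -/
def swapPoly (F : MvPolynomial (Fin 3) ℂ) : MvPolynomial (Fin 3) ℂ :=
  rename (Equiv.swap (1 : Fin 3) 2) F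

/-! ### The distinguished point -/

/-- The columns of `g` are an eigenbasis of `A`, with distinct eigenvalues `h 0, h 1, h 2` in this
order, and the entries `u₁₂`, `u₁₃` of the matrix `U = g⁻¹ B g` of `B` in this basis are not `0`. -/
structure IsEigenframe (A B : GL (Fin 3) ℂ) (h : Fin 3 → ℂ) (g : GL (Fin 3) ℂ) : Prop where
  eigen : (A : Matrix (Fin 3) (Fin 3) ℂ) * (g : Matrix (Fin 3) (Fin 3) ℂ)
    = (g : Matrix (Fin 3) (Fin 3) ℂ) * Matrix.diagonal h
  distinct : Function.Injective h
  entry12 : ((g⁻¹ * B * g : GL (Fin 3) ℂ) : Matrix (Fin 3) (Fin 3) ℂ) 0 1 ≠ 0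
  entry13 : ((g⁻¹ * B * g : GL (Fin 3) ℂ) : Matrix (Fin 3) (Fin 3) ℂ) 0 2 ≠ 0

/-- The coordinate `L`, for the eigenvalues `h` and the matrix `u` of `B` in the eigenbasis. -/
def coordL (h : Fin 3 → ℂ) (u : Matrix (Fin 3) (Fin 3) ℂ) : ℂ :=
  (u 0 1 * h 2 * (u 0 1 * u 1 2 - u 0 2 * u 1 1) + u 0 2 * h 1 * (u 0 1 * u 2 2 - u 0 2 * u 2 1))
    / (u 0 2 * u 0 1 * (h 2 - h 1))

/-- The coordinate `M`, for the eigenvalues `h` and the matrix `u` of `B` in the eigenbasis. -/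
def coordM (h : Fin 3 → ℂ) (u : Matrix (Fin 3) (Fin 3) ℂ) : ℂ :=
  -((u 0 1 * (u 0 1 * u 1 2 - u 0 2 * u 1 1) + u 0 2 * (u 0 1 * u 2 2 - u 0 2 * u 2 1))
    / (u 0 2 * u 0 1 * (h 2 - h 1)))

/-- The distinguished point `Q = (L : M : 1)` of the spectral curve of `(A, B)`, computed in the
eigenbasis `g` of `A` with eigenvalues `h`. -/
def distinguishedPoint (B : GL (Fin 3) ℂ) (h : Fin 3 → ℂ) (g : GL (Fin 3) ℂ) : PlanePt :=
  Projectivization.mk ℂ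
    ![coordL h ((g⁻¹ * B * g : GL (Fin 3) ℂ) : Matrix (Fin 3) (Fin 3) ℂ),
      coordM h ((g⁻¹ * B * g : GL (Fin 3) ℂ) : Matrix (Fin 3) (Fin 3) ℂ), 1]
    (fun h0 => one_ne_zero (congrFun h0 2))

/-- The point `(a : -1 : 0)`. For eigenvalues `a` of `A` these are the points of the spectral curve
on the line `ν = 0`. -/
def pointP (a : ℂ) : PlanePt :=
  Projectivization.mk ℂ ![a, -1, 0] (fun h0 => neg_ne_zero.mpr one_ne_zero (congrFun h0 1))

/-- The point `(b : 0 : -1)`. For eigenvalues `b` of `B` these are the points of the spectral curve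
on the line `μ = 0`. -/
def pointX (b : ℂ) : PlanePt :=
  Projectivization.mk ℂ ![b, 0, -1] (fun h0 => neg_ne_zero.mpr one_ne_zero (congrFun h0 2))

/-! ### Lines and divisors on a plane cubic -/

/-- The linear form with coefficients `c`. -/
def linForm (c : Fin 3 → ℂ) : MvPolynomial (Fin 3) ℂ := ∑ i, C (c i) * X i

/-- The intersection of the cubic `F = 0` with the line `linForm c = 0`, counted with
multiplicities, is `p + q + r`: the three points lie on the line, and the restriction of `F` to the
line is a product of three nonzero linear forms on the line that vanish at `p`, `q`, `r`
respectively. -/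
def IsLineSection (F : MvPolynomial (Fin 3) ℂ) (c : Fin 3 → ℂ) (p q r : PlanePt) : Prop :=
  c ≠ 0 ∧ VanishesAt (linForm c) p ∧ VanishesAt (linForm c) q ∧ VanishesAt (linForm c) r ∧
    ∃ a₁ a₂ a₃ : Fin 3 → ℂ,
      LinearIndependent ℂ ![c, a₁] ∧ LinearIndependent ℂ ![c, a₂] ∧
      LinearIndependent ℂ ![c, a₃] ∧
      VanishesAt (linForm a₁) p ∧ VanishesAt (linForm a₂) q ∧ VanishesAt (linForm a₃) r ∧
      linForm c ∣ F - linForm a₁ * linForm a₂ * linForm a₃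

/-- `γ` is a formal local parametrization at the point `p` of the plane curve `F = 0`: a formal arc
on the curve through `p` with a nonzero velocity in the projective plane. At a nonsingular point
such a `γ` exists, and the pullback along `γ` identifies the completed local ring of the curve at
`p` with `ℂ⟦t⟧`. -/
def IsLocalParam (F : MvPolynomial (Fin 3) ℂ) (p : PlanePt) (γ : Fin 3 → PowerSeries ℂ) : Prop :=
  aeval γ F = 0 ∧
    (∃ h0 : (fun i => PowerSeries.coeff 0 (γ i)) ≠ 0,
      Projectivization.mk ℂ (fun i => PowerSeries.coeff 0 (γ i)) h0 = p) ∧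
    LinearIndependent ℂ
      ![fun i => PowerSeries.coeff 0 (γ i), fun i => PowerSeries.coeff 1 (γ i)]

/-- The restriction to the nonsingular curve `F = 0` of the rational function `G / H`, with `G` and
`H` forms of the same degree that do not vanish identically on the curve, has the divisor `D`
(zeros minus poles): the order of `G / H` at each point of the curve is computed in a local
parameter. -/
def HasDivisor (F G H : MvPolynomial (Fin 3) ℂ) (D : PlanePt →₀ ℤ) : Prop :=
  (∃ n, G.IsHomogeneous n ∧ H.IsHomogeneous n) ∧ ¬ F ∣ G ∧ ¬ F ∣ H ∧
    (∀ p, ¬ VanishesAt F p → D p = 0) ∧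
    ∀ p γ, IsLocalParam F p γ → ∃ m n : ℕ,
      (aeval γ G : PowerSeries ℂ).order = m ∧ (aeval γ H : PowerSeries ℂ).order = n ∧
      D p = (m : ℤ) - n

/-- Linear equivalence of divisors on the nonsingular curve `F = 0`. -/
def LinEquivDiv (F : MvPolynomial (Fin 3) ℂ) (D E : PlanePt →₀ ℤ) : Prop :=
  ∃ G H : MvPolynomial (Fin 3) ℂ, HasDivisor F G H (D - E)

/-- The divisor `p + q + r`. -/
def triple (p q r : PlanePt) : PlanePt →₀ ℤ :=
  Finsupp.single p 1 + Finsupp.single q 1 + Finsupp.single r 1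

end

/-!
# Transposing the two matrices of a pair: the effect on the spectral data

After a simultaneous conjugation `(A', B')` is `(B, A)`. Let `N = λ + μ A + ν B`, and let `e`, `f`
be left eigenvectors of `A` and of `B` for the first eigenvalues. The distinguished point `Q` is the
point with `ν ≠ 0` of the spectral curve `det N = 0` at which the kernel of `N` is orthogonal to `e`
(`isKernelPoint_coord`), and `Y` is the analogous point for `(B, A)` and `f`.

Write `D` for the triple product. The line `X₁ Q` is `D(e, eB, fN) = 0` (`lineX`) and the line
`P₁ Y` is `D(f, fA, eN) = 0` (`lineP`): by `eN = (λ + μ h₁) e + ν eB` and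
`fN = (λ + ν ξ₁) f + μ fA` these are linear forms. Their common point is `T`. Indeed
`D(xN, yN, zN) = det N · D(x, y, z)`, and on the line `lineX` the vector `fN` is a combination of
`e` and `eB`; so on this line `det N` equals, up to a constant, the product of `μ`, `lineP` and
`D(e, eB, eBN)`, which vanish at `X₁`, `T` and `Q` (`IsEigenpair.det_pencil_of_lineX`). This fails
only if `lineX` is proportional to `μ`, where another such factorization takes its place
(`IsEigenpair.det_pencil_of_lineX_eq_zero`). Hence `lineX` cuts out `X₁ + Q + T`, and by symmetry
`lineP` cuts out `P₁ + T + Y`, coincidences of points included. The degenerate positions of `e`, `f`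
and of the two lines would put a line into the spectral curve, which is impossible because a
nonsingular cubic contains no line (`IsNonsingular.not_linForm_dvd`).

The uniqueness of third points is cancellation modulo a linear form, once the line is known to be
unique, the tangent if the two points coincide (`IsLineSection.third_unique`). For the divisor, the
order of a linear form along a local parametrization at `x` is the multiplicity of `x` in the line
section (`IsLineSection.order_eq`); since `μ = 0` and `ν = 0` cut out `X₁ + X₂ + X₃` and
`P₁ + P₂ + P₃`, the divisor of `(μ / ν) (ℓ₂ / ℓ₁)` is
`(X₁ + X₂ + X₃) + (P₁ + T + Y) - (P₁ + P₂ + P₃) - (X₁ + Q + T)`.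
-/

noncomputable section

/-! ### Vectors in `ℂ³` -/

theorem exists_smul_of_dotProduct_eq_zero {c a v w : Fin 3 → ℂ} (hca : LinearIndependent ℂ ![c, a])
    (hv : v ≠ 0) (hcv : c ⬝ᵥ v = 0) (hav : a ⬝ᵥ v = 0) (hcw : c ⬝ᵥ w = 0) (haw : a ⬝ᵥ w = 0) :
    ∃ s : ℂ, w = s • v := by
  have hn : c ⨯₃ a ≠ 0 := crossProduct_ne_zero_iff_linearIndependent.mpr hca
  have key : ∀ u : Fin 3 → ℂ, c ⬝ᵥ u = 0 → a ⬝ᵥ u = 0 → (c ⨯₃ a) ⨯₃ u = 0 := by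
    intro u h1 h2
    rw [cross_cross_eq_smul_sub_smul, h1, h2]
    simp
  have dep : ∀ u : Fin 3 → ℂ, c ⬝ᵥ u = 0 → a ⬝ᵥ u = 0 → ∃ s : ℂ, s • (c ⨯₃ a) = u := by
    intro u h1 h2
    by_contra hne
    push Not at hne
    exact crossProduct_ne_zero_iff_linearIndependent.mpr
      ((LinearIndependent.pair_iff' hn).mpr hne) (key u h1 h2)
  obtain ⟨s, hs⟩ := dep v hcv hav
  obtain ⟨t, ht⟩ := dep w hcw haw
  have hs0 : s ≠ 0 := by
    rintro rfl
    exact hv (by rw [← hs, zero_smul])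
  exact ⟨t / s, by rw [← hs, ← ht, smul_smul, div_mul_cancel₀ _ hs0]⟩

theorem dotProduct_cross_eq_zero_of_common {a b c v : Fin 3 → ℂ} (hv : v ≠ 0) (ha : a ⬝ᵥ v = 0)
    (hb : b ⬝ᵥ v = 0) (hc : c ⬝ᵥ v = 0) : a ⬝ᵥ b ⨯₃ c = 0 := by
  rw [triple_product_eq_det]
  refine Matrix.exists_mulVec_eq_zero_iff.mp ⟨v, hv, ?_⟩
  ext i
  fin_cases i
  · exact ha
  · exact hb
  · exact hc

theorem exists_combination {b c a : Fin 3 → ℂ} (hca : LinearIndependent ℂ ![c, a])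
    (h : b ⬝ᵥ c ⨯₃ a = 0) : ∃ s t : ℂ, s • c + t • a = b := by
  rw [triple_product_eq_det] at h
  have hdep : ¬ LinearIndependent ℂ ![b, c, a] := by
    intro hli
    have := (Matrix.linearIndependent_rows_iff_isUnit (A := Matrix.of ![b, c, a])).mp hli
    exact ((Matrix.isUnit_iff_isUnit_det _).mp this).ne_zero h
  have : b ∈ Submodule.span ℂ (Set.range ![c, a]) := by
    by_contra hb
    exact hdep (linearIndependent_finCons.mpr ⟨hca, hb⟩)
  obtain ⟨s, t, hst⟩ : ∃ s t : ℂ, s • a + t • c = b := by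
    simpa [Submodule.mem_span_pair] using this
  exact ⟨t, s, by rw [add_comm, hst]⟩

theorem exists_combination_of_dotProduct_eq_zero {b c a v : Fin 3 → ℂ}
    (hca : LinearIndependent ℂ ![c, a]) (hv : v ≠ 0) (hc : c ⬝ᵥ v = 0) (ha : a ⬝ᵥ v = 0)
    (hb : b ⬝ᵥ v = 0) : ∃ s t : ℂ, s • c + t • a = b :=
  exists_combination hca (dotProduct_cross_eq_zero_of_common hv hb hc ha)

/-! ### Linear forms and homogeneous forms -/

@[simp]
theorem eval_linForm (c x : Fin 3 → ℂ) : eval x (linForm c) = c ⬝ᵥ x := by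
  simp [linForm, dotProduct]

theorem pderiv_linForm (c : Fin 3 → ℂ) (i : Fin 3) : pderiv i (linForm c) = C (c i) := by
  fin_cases i <;> simp [linForm, Fin.sum_univ_three, pderiv_X]

theorem isHomogeneous_linForm (c : Fin 3 → ℂ) : (linForm c).IsHomogeneous 1 :=
  IsHomogeneous.sum _ _ _ fun i _ => by
    simpa using (isHomogeneous_X ℂ i).C_mul (c i)

theorem linForm_ne_zero {c : Fin 3 → ℂ} (hc : c ≠ 0) : linForm c ≠ 0 := by
  intro h
  apply hc
  ext i
  have := congrArg (eval (Pi.single i 1)) h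
  simpa using this

theorem linForm_smul (s : ℂ) (c : Fin 3 → ℂ) : linForm (s • c) = C s * linForm c := by
  simp [linForm, Finset.mul_sum, mul_assoc]

theorem linForm_add (c d : Fin 3 → ℂ) : linForm (c + d) = linForm c + linForm d := by
  simp [linForm, add_mul, Finset.sum_add_distrib]

/-- The substitution that projects the coordinates onto the plane `linForm c = 0` along the `i`-th
coordinate axis. It is that projection only if `c i ≠ 0`. -/
def planeSubst (c : Fin 3 → ℂ) (i : Fin 3) : MvPolynomial (Fin 3) ℂ →ₐ[ℂ] MvPolynomial (Fin 3) ℂ :=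
  aeval fun j => X j - (if j = i then C (c i)⁻¹ * linForm c else 0)

theorem linForm_dvd_sub_planeSubst (c : Fin 3 → ℂ) (i : Fin 3) (F : MvPolynomial (Fin 3) ℂ) :
    linForm c ∣ F - planeSubst c i F := by
  induction F using MvPolynomial.induction_on with
  | C a => simp [planeSubst]
  | add p q hp hq =>
    rw [map_add, add_sub_add_comm]
    exact dvd_add hp hq
  | mul_X p j hp =>
    have : p * X j - planeSubst c i (p * X j)
        = (p - planeSubst c i p) * X j + planeSubst c i p * (X j - planeSubst c i (X j)) := by
      rw [map_mul]; ring
    rw [this]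
    refine dvd_add (hp.mul_right _) (Dvd.dvd.mul_left ?_ _)
    by_cases hj : j = i <;> simp [planeSubst, hj]

theorem planeSubst_linForm {c : Fin 3 → ℂ} {i : Fin 3} (hi : c i ≠ 0) :
    planeSubst c i (linForm c) = 0 := by
  have h : ∀ j, planeSubst c i (C (c j) * X j)
      = C (c j) * X j - (if j = i then linForm c else 0) := by
    intro j
    by_cases hj : j = i
    · subst hj
      simp [planeSubst, mul_sub, ← mul_assoc, ← C_mul, hi, algebraMap_eq]
    · simp [planeSubst, hj, algebraMap_eq]
  conv_lhs => rw [linForm, map_sum]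
  simp_rw [h]
  simp [Finset.sum_sub_distrib, linForm]

theorem linForm_dvd_iff_planeSubst {c : Fin 3 → ℂ} {i : Fin 3} (hi : c i ≠ 0)
    (F : MvPolynomial (Fin 3) ℂ) : linForm c ∣ F ↔ planeSubst c i F = 0 := by
  constructor
  · rintro ⟨q, rfl⟩
    rw [map_mul, planeSubst_linForm hi, zero_mul]
  · intro h
    simpa [h] using linForm_dvd_sub_planeSubst c i F

/-- A multiple of `linForm c` is an element of the kernel of `planeSubst`, whose target is a
domain. -/
theorem prime_linForm {c : Fin 3 → ℂ} (hc : c ≠ 0) : Prime (linForm c) := by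
  obtain ⟨i, hi⟩ := Function.ne_iff.mp hc
  refine ⟨linForm_ne_zero hc, ?_, ?_⟩
  · rw [isUnit_iff_dvd_one, linForm_dvd_iff_planeSubst hi, map_one]
    exact one_ne_zero
  · intro p q
    simp only [linForm_dvd_iff_planeSubst hi, map_mul, mul_eq_zero, imp_self]

theorem linForm_dvd_iff_eval {c : Fin 3 → ℂ} (hc : c ≠ 0) (F : MvPolynomial (Fin 3) ℂ) :
    linForm c ∣ F ↔ ∀ x, c ⬝ᵥ x = 0 → eval x F = 0 := by
  obtain ⟨i, hi⟩ := Function.ne_iff.mp hc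
  constructor
  · rintro ⟨q, rfl⟩ x hx
    simp [hx]
  · intro h
    rw [linForm_dvd_iff_planeSubst hi]
    apply MvPolynomial.funext
    intro x
    have hx : eval x (planeSubst c i F)
        = eval (fun j => x j - (if j = i then (c i)⁻¹ * (c ⬝ᵥ x) else 0)) F := by
      rw [planeSubst, aeval_def, algebraMap_eq, eval_eval₂, eval, coe_eval₂Hom]
      congr 1
      · ext; simp
      · ext j
        by_cases hj : j = i <;> simp [hj, ← eval_linForm]
    rw [hx, h, map_zero]
    have : (fun j => x j - (if j = i then (c i)⁻¹ * (c ⬝ᵥ x) else 0))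
        = x - Pi.single i ((c i)⁻¹ * (c ⬝ᵥ x)) := by
      ext j
      simp [Pi.single_apply]
    rw [this, dotProduct_sub, dotProduct_single, mul_inv_cancel_left₀ hi, sub_self]

theorem not_linForm_dvd {c a : Fin 3 → ℂ} (h : LinearIndependent ℂ ![c, a]) :
    ¬ linForm c ∣ linForm a := by
  have hc : c ≠ 0 := h.ne_zero 0
  rw [linForm_dvd_iff_eval hc]
  intro H
  obtain ⟨i, hi⟩ := Function.ne_iff.mp (crossProduct_ne_zero_iff_linearIndependent.mpr h)
  -- this vector lies in the plane, and `a` takes on it the value of the `i`-th entry of `c ⨯₃ a`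
  have h2 := H (Pi.single i 1 ⨯₃ c) (by simp)
  rw [eval_linForm, triple_product_permutation] at h2
  exact hi (by simpa using h2)

theorem eval_smul_of_isHomogeneous {F : MvPolynomial (Fin 3) ℂ} {n : ℕ} (hF : F.IsHomogeneous n)
    (a : ℂ) (v : Fin 3 → ℂ) : eval (a • v) F = a ^ n * eval v F := by
  rw [eval_eq', eval_eq', Finset.mul_sum]
  refine Finset.sum_congr rfl fun d hd => ?_
  have hdn : ∑ i, d i = n := by
    rw [← Finsupp.degree_eq_sum]
    by_contra hne
    exact mem_support_iff.mp hd (hF.coeff_eq_zero hne)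
  simp only [Pi.smul_apply, smul_eq_mul, mul_pow, Finset.prod_mul_distrib,
    Finset.prod_pow_eq_pow_sum, hdn]
  ring

theorem vanishesAt_mk {F : MvPolynomial (Fin 3) ℂ} {n : ℕ} (hF : F.IsHomogeneous n)
    {v : Fin 3 → ℂ} (hv : v ≠ 0) :
    VanishesAt F (Projectivization.mk ℂ v hv) ↔ eval v F = 0 := by
  obtain ⟨a, ha⟩ := Projectivization.exists_smul_eq_mk_rep ℂ v hv
  rw [VanishesAt, ← ha, Units.smul_def, eval_smul_of_isHomogeneous hF]
  simp

theorem vanishesAt_linForm_mk {c v : Fin 3 → ℂ} (hv : v ≠ 0) :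
    VanishesAt (linForm c) (Projectivization.mk ℂ v hv) ↔ c ⬝ᵥ v = 0 := by
  rw [vanishesAt_mk (isHomogeneous_linForm c) hv, eval_linForm]

theorem IsNonsingular.exists_pderiv_ne_zero {F : MvPolynomial (Fin 3) ℂ} {n : ℕ}
    (hF : F.IsHomogeneous n) (hs : IsNonsingular F) {v : Fin 3 → ℂ} (hv : v ≠ 0)
    (h : eval v F = 0) : ∃ i, eval v (pderiv i F) ≠ 0 := by
  obtain ⟨i, hi⟩ := hs (Projectivization.mk ℂ v hv) ((vanishesAt_mk hF hv).mpr h)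
  exact ⟨i, fun h0 => hi ((vanishesAt_mk hF.pderiv hv).mpr h0)⟩

/-- A form on a line, written in the basis `u, v` of a plane in `ℂ³`, has a zero. -/
theorem exists_zero_on_line {R : MvPolynomial (Fin 3) ℂ} {n : ℕ} (hR : R.IsHomogeneous n)
    (hn : n ≠ 0) (u v : Fin 3 → ℂ) (huv : LinearIndependent ℂ ![u, v]) :
    ∃ s t : ℂ, s • u + t • v ≠ 0 ∧ eval (s • u + t • v) R = 0 := by
  have hli := LinearIndependent.pair_iff.mp huv
  let P : (Fin 3 → ℂ) → (Fin 3 → ℂ) → Polynomial ℂ := fun u v =>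
    aeval (fun i => Polynomial.C (u i) + Polynomial.X * Polynomial.C (v i)) R
  have hP : ∀ (u v : Fin 3 → ℂ) (t : ℂ), (P u v).eval t = eval (u + t • v) R := by
    intro u v t
    simp only [P]
    rw [← Polynomial.coe_evalRingHom, aeval_def, hom_eval₂, eval, coe_eval₂Hom]
    congr 1
    · ext; simp
    · ext i; simp; ring
  -- a root of `R` along `u + t v` or along `v + t u` will do; if both restrictions are constant,
  -- homogeneity under `u + t v = t (v + t⁻¹ u)` forces `t ^ n = 1` for all `t ≠ 0`
  by_cases h1 : (P u v).degree = 0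
  · by_cases h2 : (P v u).degree = 0
    · exfalso
      obtain ⟨a, ha⟩ : ∃ a, P u v = Polynomial.C a := ⟨_, Polynomial.eq_C_of_degree_eq_zero h1⟩
      obtain ⟨b, hb⟩ : ∃ b, P v u = Polynomial.C b := ⟨_, Polynomial.eq_C_of_degree_eq_zero h2⟩
      have hab : ∀ t : ℂ, t ≠ 0 → a = t ^ n * b := by
        intro t ht
        have e1 := hP u v t
        have e2 := hP v u t⁻¹
        have : u + t • v = t • (v + t⁻¹ • u) := by
          rw [smul_add, smul_smul, mul_inv_cancel₀ ht, one_smul, add_comm]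
        rw [this, eval_smul_of_isHomogeneous hR, ← e2, ha, hb] at e1
        simpa using e1
      have e1 := hab 1 one_ne_zero
      have e2 := hab 2 two_ne_zero
      rw [one_pow, one_mul] at e1
      have hb0 : b ≠ 0 := by
        rintro rfl
        rw [hb] at h2
        simp at h2
      rw [e1] at e2
      have : (2 : ℂ) ^ n = 1 := mul_right_cancel₀ hb0 (by rw [one_mul]; exact e2.symm)
      have h3 : (2 : ℕ) ^ n = 1 := by exact_mod_cast this
      simp [hn] at h3
    · obtain ⟨t, ht⟩ := IsAlgClosed.exists_root _ h2
      refine ⟨t, 1, fun h0 => one_ne_zero (hli t 1 h0).2, ?_⟩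
      rw [one_smul, add_comm, ← hP]
      exact ht
  · obtain ⟨t, ht⟩ := IsAlgClosed.exists_root _ h1
    refine ⟨1, t, fun h0 => one_ne_zero (hli 1 t h0).1, ?_⟩
    rw [one_smul, ← hP]
    exact ht

/-- A nonsingular curve of degree at least two contains no line: on a linear component the
residual form has a zero, where all derivatives of `F` vanish. -/
theorem IsNonsingular.not_linForm_dvd {F : MvPolynomial (Fin 3) ℂ} {n : ℕ}
    (hF : F.IsHomogeneous n) (hn : 2 ≤ n) (hs : IsNonsingular F) {c : Fin 3 → ℂ} (hc : c ≠ 0) :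
    ¬ linForm c ∣ F := by
  rintro ⟨q, rfl⟩
  obtain ⟨i, hi⟩ := Function.ne_iff.mp hc
  have hi' : c i ≠ 0 := hi
  -- a basis of the plane `c ⬝ᵥ x = 0`
  obtain ⟨u, v, huv, hu, hv⟩ : ∃ u v : Fin 3 → ℂ, LinearIndependent ℂ ![u, v] ∧ c ⬝ᵥ u = 0 ∧
      c ⬝ᵥ v = 0 := by
    have key : ∀ j k : Fin 3, j ≠ i → k ≠ i → j ≠ k → ∃ u v : Fin 3 → ℂ,
        LinearIndependent ℂ ![u, v] ∧ c ⬝ᵥ u = 0 ∧ c ⬝ᵥ v = 0 := by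
      intro j k hj hk hjk
      refine ⟨c i • Pi.single j 1 - c j • Pi.single i 1, c i • Pi.single k 1 - c k • Pi.single i 1,
        LinearIndependent.pair_iff.mpr fun s t hst => ?_, ?_, ?_⟩
      · have h1 := congrFun hst j
        have h2 := congrFun hst k
        simp [hj, hk, hjk, hjk.symm, hi'] at h1 h2
        exact ⟨h1, h2⟩
      · simp [dotProduct_sub, mul_comm]
      · simp [dotProduct_sub, mul_comm]
    fin_cases i
    · exact key 1 2 (by simp) (by simp) (by simp)
    · exact key 0 2 (by simp) (by simp) (by simp)
    · exact key 0 1 (by simp) (by simp) (by simp)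
  have hd : ∀ x, c ⬝ᵥ x = 0 → ∀ j, eval x (pderiv j (linForm c * q)) = c j * eval x q := by
    intro x hx j
    simp [pderiv_linForm, hx, mul_comm]
  -- on the plane, the `i`-th derivative is the residual form up to the constant `c i ≠ 0`
  obtain ⟨s, t, hne, hz⟩ := exists_zero_on_line (hF.pderiv (i := i)) (by lia) u v huv
  have hx : c ⬝ᵥ (s • u + t • v) = 0 := by simp [dotProduct_add, hu, hv]
  rw [hd _ hx] at hz
  obtain ⟨j, hj⟩ := hs.exists_pderiv_ne_zero hF hne (by simp [hx])
  rw [hd _ hx, (mul_eq_zero.mp hz).resolve_left hi', mul_zero] at hj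
  exact hj rfl

/-! ### Line sections -/

/-- A line section can be certified on vectors: the restriction of `F` to the line need only be
compared pointwise with the product of three linear forms. -/
theorem IsLineSection.of_eval {F : MvPolynomial (Fin 3) ℂ} {c p q r a₁ a₂ a₃ : Fin 3 → ℂ}
    (hp : p ≠ 0) (hq : q ≠ 0) (hr : r ≠ 0)
    (hcp : c ⬝ᵥ p = 0) (hcq : c ⬝ᵥ q = 0) (hcr : c ⬝ᵥ r = 0)
    (h₁ : LinearIndependent ℂ ![c, a₁]) (h₂ : LinearIndependent ℂ ![c, a₂])
    (h₃ : LinearIndependent ℂ ![c, a₃])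
    (hap : a₁ ⬝ᵥ p = 0) (haq : a₂ ⬝ᵥ q = 0) (har : a₃ ⬝ᵥ r = 0)
    (h : ∀ x, c ⬝ᵥ x = 0 → eval x F = (a₁ ⬝ᵥ x) * (a₂ ⬝ᵥ x) * (a₃ ⬝ᵥ x)) :
    IsLineSection F c (Projectivization.mk ℂ p hp) (Projectivization.mk ℂ q hq)
      (Projectivization.mk ℂ r hr) := by
  have hc : c ≠ 0 := h₁.ne_zero 0
  refine ⟨hc, ?_, ?_, ?_, a₁, a₂, a₃, h₁, h₂, h₃, ?_, ?_, ?_, ?_⟩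
  iterate 6 rwa [vanishesAt_linForm_mk]
  rw [linForm_dvd_iff_eval hc]
  intro x hx
  simp [h x hx]

theorem IsLineSection.vanishesAt {F : MvPolynomial (Fin 3) ℂ} {c : Fin 3 → ℂ} {p q r : PlanePt}
    (h : IsLineSection F c p q r) : VanishesAt F p ∧ VanishesAt F q ∧ VanishesAt F r := by
  obtain ⟨hc, hp, hq, hr, a₁, a₂, a₃, -, -, -, h₁, h₂, h₃, hd⟩ := h
  rw [linForm_dvd_iff_eval hc] at hd
  simp only [VanishesAt, eval_linForm, map_sub, map_mul, sub_eq_zero] at *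
  refine ⟨?_, ?_, ?_⟩
  · rw [hd _ hp, h₁]; ring
  · rw [hd _ hq, h₂]; ring
  · rw [hd _ hr, h₃]; ring

/-- At a point where two of the factors on the line vanish, the gradient of `F` is a nonzero
multiple of the coefficient vector of the line. -/
theorem residual_ne_zero {F q : MvPolynomial (Fin 3) ℂ} {n : ℕ} (hF : F.IsHomogeneous n)
    (hs : IsNonsingular F) {c a₁ a₂ a₃ v : Fin 3 → ℂ} (hv : v ≠ 0) (hcv : c ⬝ᵥ v = 0)
    (h : F - linForm a₁ * linForm a₂ * linForm a₃ = linForm c * q)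
    (h2 : (a₁ ⬝ᵥ v = 0 ∧ a₂ ⬝ᵥ v = 0) ∨ (a₁ ⬝ᵥ v = 0 ∧ a₃ ⬝ᵥ v = 0) ∨
      (a₂ ⬝ᵥ v = 0 ∧ a₃ ⬝ᵥ v = 0)) :
    eval v q ≠ 0 ∧ ∀ i, eval v (pderiv i F) = c i * eval v q := by
  have hFe : F = linForm a₁ * linForm a₂ * linForm a₃ + linForm c * q := by rw [← h]; ring
  have hgrad : ∀ i, eval v (pderiv i F) = c i * eval v q := by
    intro i
    rw [hFe]
    rcases h2 with ⟨h2, h3⟩ | ⟨h2, h3⟩ | ⟨h2, h3⟩ <;>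
      simp [pderiv_linForm, hcv, h2, h3, mul_comm]
  refine ⟨fun hq => ?_, hgrad⟩
  have hFv : eval v F = 0 := by
    rw [hFe]
    rcases h2 with ⟨h2, h3⟩ | ⟨h2, h3⟩ | ⟨h2, h3⟩ <;> simp [hcv, h2, h3]
  obtain ⟨i, hi⟩ := hs.exists_pderiv_ne_zero hF hv hFv
  exact hi (by rw [hgrad, hq, mul_zero])

theorem eq_of_common_zero {c a : Fin 3 → ℂ} (h : LinearIndependent ℂ ![c, a]) {p q : PlanePt}
    (hcp : VanishesAt (linForm c) p) (hap : VanishesAt (linForm a) p)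
    (hcq : VanishesAt (linForm c) q) (haq : VanishesAt (linForm a) q) : p = q := by
  simp only [VanishesAt, eval_linForm] at *
  obtain ⟨s, hs⟩ := exists_smul_of_dotProduct_eq_zero h q.rep_nonzero hcq haq hcp hap
  rw [← p.mk_rep, ← q.mk_rep, Projectivization.mk_eq_mk_iff']
  exact ⟨s, hs.symm⟩

/-- A line that meets a nonsingular curve in `p + q + ⋯` is determined by `p` and `q`: it is the
tangent line if `p = q`. -/
theorem IsLineSection.exists_smul_eq {F : MvPolynomial (Fin 3) ℂ} {n : ℕ} (hF : F.IsHomogeneous n)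
    (hs : IsNonsingular F) {c c' : Fin 3 → ℂ} {p q r r' : PlanePt}
    (h : IsLineSection F c p q r) (h' : IsLineSection F c' p q r') : ∃ s : ℂ, s • c = c' := by
  by_contra hne
  push Not at hne
  have hli : LinearIndependent ℂ ![c, c'] := (LinearIndependent.pair_iff' h.1).mpr hne
  have hpq : p = q := eq_of_common_zero hli h.2.1 h'.2.1 h.2.2.1 h'.2.2.1
  subst hpq
  obtain ⟨hc, hp, -, -, a₁, a₂, a₃, -, -, -, h₁, h₂, -, Q, hQ⟩ := h
  obtain ⟨-, hp', -, -, b₁, b₂, b₃, -, -, -, h₁', h₂', -, Q', hQ'⟩ := h'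
  simp only [VanishesAt, eval_linForm] at *
  obtain ⟨-, hg⟩ := residual_ne_zero hF hs p.rep_nonzero hp hQ (Or.inl ⟨h₁, h₂⟩)
  obtain ⟨hne', hg'⟩ := residual_ne_zero hF hs p.rep_nonzero hp' hQ' (Or.inl ⟨h₁', h₂'⟩)
  refine hne (eval p.rep Q / eval p.rep Q') ?_
  ext i
  have := (hg i).symm.trans (hg' i)
  simp only [Pi.smul_apply, smul_eq_mul]
  field_simp
  linear_combination this

/-- The third point of intersection of a line with a nonsingular curve is determined by the other
two: on the line, the factors of `F` that vanish at `p` and `q` can be cancelled. -/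
theorem IsLineSection.third_unique {F : MvPolynomial (Fin 3) ℂ} {n : ℕ} (hF : F.IsHomogeneous n)
    (hs : IsNonsingular F) {c c' : Fin 3 → ℂ} {p q r r' : PlanePt}
    (h : IsLineSection F c p q r) (h' : IsLineSection F c' p q r') : r' = r := by
  obtain ⟨s, rfl⟩ := h.exists_smul_eq hF hs h'
  obtain ⟨hc, hp, hq, hr, a₁, a₂, a₃, i₁, i₂, i₃, h₁, h₂, h₃, hd⟩ := h
  obtain ⟨hc', -, -, hr', b₁, b₂, b₃, j₁, j₂, j₃, h₁', h₂', h₃', hd'⟩ := h'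
  have hs0 : s ≠ 0 := fun h0 => hc' (by rw [h0, zero_smul])
  have hdvd : linForm c ∣ linForm (s • c) := by
    rw [linForm_smul]; exact Dvd.intro_left _ rfl
  have hcr' : VanishesAt (linForm c) r' := by
    simp only [VanishesAt, eval_linForm] at *
    simpa [hs0] using hr'
  have hP := prime_linForm hc
  -- modulo the line, a linear form vanishing at a point of it is unique up to a scalar
  have comb : ∀ {a b : Fin 3 → ℂ} {x : PlanePt}, LinearIndependent ℂ ![c, a] →
      VanishesAt (linForm c) x → VanishesAt (linForm a) x → VanishesAt (linForm b) x →
      ∃ t, linForm c ∣ linForm b - C t * linForm a := by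
    intro a b x hca h1 h2 h3
    simp only [VanishesAt, eval_linForm] at h1 h2 h3
    obtain ⟨t, t', ht⟩ := exists_combination_of_dotProduct_eq_zero hca x.rep_nonzero h1 h2 h3
    refine ⟨t', C t, ?_⟩
    rw [← ht, linForm_add, linForm_smul, linForm_smul]
    ring
  obtain ⟨t₁, d₁⟩ := comb i₁ hp h₁ h₁'
  obtain ⟨t₂, d₂⟩ := comb i₂ hq h₂ h₂'
  have key : linForm c ∣ linForm a₁ * linForm a₂ *
      (linForm a₃ - C (t₁ * t₂) * linForm b₃) := by
    have e : linForm a₁ * linForm a₂ * (linForm a₃ - C (t₁ * t₂) * linForm b₃)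
        = (F - linForm b₁ * linForm b₂ * linForm b₃) - (F - linForm a₁ * linForm a₂ * linForm a₃)
          + (linForm b₁ - C t₁ * linForm a₁) * (linForm b₂ * linForm b₃)
          + (linForm b₂ - C t₂ * linForm a₂) * (C t₁ * linForm a₁ * linForm b₃) := by
      rw [C_mul]; ring
    rw [e]
    exact dvd_add (dvd_add (dvd_sub (hdvd.trans hd') hd) (d₁.mul_right _)) (d₂.mul_right _)
  have key' := ((hP.dvd_or_dvd key).resolve_left fun h12 =>
    (hP.dvd_or_dvd h12).elim (not_linForm_dvd i₁) (not_linForm_dvd i₂))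
  rw [linForm_dvd_iff_eval hc] at key'
  have h3 := key' r'.rep (by simpa only [VanishesAt, eval_linForm] using hcr')
  have hb : b₃ ⬝ᵥ r'.rep = 0 := by simpa only [VanishesAt, eval_linForm] using h₃'
  refine eq_of_common_zero i₃ hcr' ?_ hr h₃
  simpa [VanishesAt, hb] using h3

/-! ### Orders along a local parametrization -/

theorem coeff_aeval_linForm (k : ℕ) (γ : Fin 3 → PowerSeries ℂ) (c : Fin 3 → ℂ) :
    PowerSeries.coeff k (aeval γ (linForm c) : PowerSeries ℂ)
      = c ⬝ᵥ fun i => PowerSeries.coeff k (γ i) := by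
  simp [linForm, dotProduct]

theorem constantCoeff_aeval (γ : Fin 3 → PowerSeries ℂ) (F : MvPolynomial (Fin 3) ℂ) :
    PowerSeries.constantCoeff (aeval γ F : PowerSeries ℂ)
      = eval (fun i => PowerSeries.coeff 0 (γ i)) F := by
  rw [aeval_def, hom_eval₂, eval, coe_eval₂Hom]
  congr 1
  ext a
  simp

theorem order_eq_one {f : PowerSeries ℂ} (h0 : PowerSeries.coeff 0 f = 0)
    (h1 : PowerSeries.coeff 1 f ≠ 0) : f.order = (1 : ℕ) := by
  rw [PowerSeries.order_eq_nat]
  refine ⟨h1, fun i hi => ?_⟩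
  rwa [Nat.lt_one_iff.mp hi]

theorem order_eq_zero {f : PowerSeries ℂ} (h0 : PowerSeries.constantCoeff f ≠ 0) :
    f.order = (0 : ℕ) := by
  exact_mod_cast PowerSeries.order_zero_of_unit
    (PowerSeries.isUnit_iff_constantCoeff.mpr h0.isUnit)

theorem coeff_one_mul_of_coeff_zero {f g : PowerSeries ℂ} (h : PowerSeries.coeff 0 f = 0) :
    PowerSeries.coeff 1 (f * g) = PowerSeries.coeff 1 f * PowerSeries.constantCoeff g := by
  rw [PowerSeries.coeff_mul, Finset.Nat.antidiagonal_succ]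
  simp [h]

open Classical in
/-- The intersection multiplicity of a line with a nonsingular curve at a point `x`, read off from
a local parametrization, is the multiplicity of `x` in the line section. -/
theorem IsLineSection.order_eq {F : MvPolynomial (Fin 3) ℂ} {n : ℕ} (hF : F.IsHomogeneous n)
    (hs : IsNonsingular F) {c : Fin 3 → ℂ} {p q r : PlanePt} (h : IsLineSection F c p q r)
    {x : PlanePt} {γ : Fin 3 → PowerSeries ℂ} (hγ : IsLocalParam F x γ) :
    (aeval γ (linForm c) : PowerSeries ℂ).order =
      (((if p = x then 1 else 0) + (if q = x then 1 else 0) + (if r = x then 1 else 0) : ℕ) : ℕ∞)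
    := by
  obtain ⟨hFγ, ⟨hv, hx⟩, hli⟩ := hγ
  obtain ⟨hc, hp, hq, hr, a₁, a₂, a₃, i₁, i₂, i₃, h₁, h₂, h₃, R, hR⟩ := h
  set v : Fin 3 → ℂ := fun i => PowerSeries.coeff 0 (γ i) with hvdef
  set w : Fin 3 → ℂ := fun i => PowerSeries.coeff 1 (γ i) with hwdef
  have hid : -(aeval γ (linForm a₁) * aeval γ (linForm a₂) * aeval γ (linForm a₃) : PowerSeries ℂ)
      = aeval γ (linForm c) * aeval γ R := by
    have := congrArg (aeval γ) hR
    simpa [hFγ] using this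
  have e0 : ∀ a, PowerSeries.coeff 0 (aeval γ (linForm a) : PowerSeries ℂ) = a ⬝ᵥ v :=
    fun a => coeff_aeval_linForm 0 γ a
  have e0' : ∀ a, PowerSeries.constantCoeff (aeval γ (linForm a) : PowerSeries ℂ) = a ⬝ᵥ v :=
    fun a => by rw [← PowerSeries.coeff_zero_eq_constantCoeff_apply, e0]
  have e1 : ∀ a, PowerSeries.coeff 1 (aeval γ (linForm a) : PowerSeries ℂ) = a ⬝ᵥ w :=
    fun a => coeff_aeval_linForm 1 γ a
  have hcx : VanishesAt (linForm c) x ↔ c ⬝ᵥ v = 0 := by rw [← hx, vanishesAt_linForm_mk]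
  by_cases hcv : c ⬝ᵥ v = 0
  swap
  · have hno : ∀ y : PlanePt, VanishesAt (linForm c) y → y ≠ x := by
      rintro y hy rfl
      exact hcv (hcx.mp hy)
    rw [order_eq_zero (by rwa [e0']), if_neg (hno p hp), if_neg (hno q hq), if_neg (hno r hr)]
  -- on the line, `x` is the zero of a factor exactly if the factor vanishes at `γ 0`
  have hiff : ∀ {a : Fin 3 → ℂ} {y : PlanePt}, LinearIndependent ℂ ![c, a] →
      VanishesAt (linForm c) y → VanishesAt (linForm a) y → (y = x ↔ a ⬝ᵥ v = 0) := by
    intro a y hca hcy hay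
    constructor
    · rintro rfl
      rwa [← hx, vanishesAt_linForm_mk] at hay
    · intro hav
      exact eq_of_common_zero hca hcy hay (hcx.mpr hcv) (by rwa [← hx, vanishesAt_linForm_mk])
  -- a form vanishing at `γ 0` along with `linForm c` separates the velocity if `linForm c` does not
  have hvel : ∀ {a : Fin 3 → ℂ}, LinearIndependent ℂ ![c, a] → c ⬝ᵥ w = 0 → a ⬝ᵥ v = 0 →
      a ⬝ᵥ w ≠ 0 := by
    intro a hca hcw hav haw
    obtain ⟨s, hsw⟩ := exists_smul_of_dotProduct_eq_zero hca hv hcv hav hcw haw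
    exact (LinearIndependent.pair_iff' hv).mp hli s hsw.symm
  have hRv : PowerSeries.constantCoeff (aeval γ R : PowerSeries ℂ) = eval v R :=
    constantCoeff_aeval γ R
  -- where two factors vanish, the line is tangent and the residual factor is a unit
  have multi : (a₁ ⬝ᵥ v = 0 ∧ a₂ ⬝ᵥ v = 0) ∨ (a₁ ⬝ᵥ v = 0 ∧ a₃ ⬝ᵥ v = 0) ∨
      (a₂ ⬝ᵥ v = 0 ∧ a₃ ⬝ᵥ v = 0) → (aeval γ (linForm c) : PowerSeries ℂ).order =
      (((if p = x then 1 else 0) + (if q = x then 1 else 0) + (if r = x then 1 else 0) : ℕ) : ℕ∞)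
      := by
    intro h2
    obtain ⟨hR0, -⟩ := residual_ne_zero hF hs hv hcv hR h2
    have hcw : c ⬝ᵥ w = 0 := by
      have := congrArg (PowerSeries.coeff 1) hid
      rw [coeff_one_mul_of_coeff_zero (by rw [e0, hcv]), e1, hRv, map_neg] at this
      have hz : PowerSeries.coeff 1 (aeval γ (linForm a₁) * aeval γ (linForm a₂) *
          aeval γ (linForm a₃) : PowerSeries ℂ) = 0 := by
        rcases h2 with ⟨k1, k2⟩ | ⟨k1, k2⟩ | ⟨k1, k2⟩
        · rw [mul_assoc, coeff_one_mul_of_coeff_zero (by rw [e0, k1]), map_mul, e0', e0', k2]; simp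
        · rw [mul_assoc, coeff_one_mul_of_coeff_zero (by rw [e0, k1]), map_mul, e0', e0', k2]; simp
        · rw [mul_comm (aeval γ (linForm a₁)), mul_assoc,
            coeff_one_mul_of_coeff_zero (by rw [e0, k1]), map_mul, e0', e0', k2]; simp
      rw [hz, neg_zero] at this
      exact (mul_eq_zero.mp this.symm).resolve_right hR0
    have ho : ∀ {a : Fin 3 → ℂ} {y : PlanePt}, LinearIndependent ℂ ![c, a] →
        VanishesAt (linForm c) y → VanishesAt (linForm a) y →
        (aeval γ (linForm a) : PowerSeries ℂ).order = ((if y = x then 1 else 0 : ℕ) : ℕ∞) := by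
      intro a y hca hcy hay
      by_cases hyx : y = x
      · have hav := (hiff hca hcy hay).mp hyx
        rw [if_pos hyx]
        exact order_eq_one (by rw [e0, hav]) (by rw [e1]; exact hvel hca hcw hav)
      · rw [if_neg hyx]
        exact order_eq_zero (by rw [e0']; exact fun h0 => hyx ((hiff hca hcy hay).mpr h0))
    have := congrArg PowerSeries.order hid
    rw [PowerSeries.order_neg, PowerSeries.order_mul, PowerSeries.order_mul, PowerSeries.order_mul,
      ho i₁ hp h₁, ho i₂ hq h₂, ho i₃ hr h₃, order_eq_zero (f := aeval γ R) (by rwa [hRv])] at this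
    rw [Nat.cast_zero, add_zero] at this
    rw [← this]
    push_cast
    rfl
  -- where just one factor vanishes, the line is transversal to the curve
  have single : ∀ {a b d : Fin 3 → ℂ}, LinearIndependent ℂ ![c, a] → a ⬝ᵥ v = 0 → b ⬝ᵥ v ≠ 0 →
      d ⬝ᵥ v ≠ 0 → -(aeval γ (linForm a) * (aeval γ (linForm b) * aeval γ (linForm d)) :
      PowerSeries ℂ) = aeval γ (linForm c) * aeval γ R →
      (aeval γ (linForm c) : PowerSeries ℂ).order = (1 : ℕ) := by
    intro a b d hca ha hb hd hid'
    refine order_eq_one (by rw [e0, hcv]) ?_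
    rw [e1]
    intro hcw
    have := congrArg (PowerSeries.coeff 1) hid'
    rw [coeff_one_mul_of_coeff_zero (by rw [e0, hcv]), map_neg,
      coeff_one_mul_of_coeff_zero (by rw [e0, ha]), e1, e1, hcw, zero_mul, map_mul,
      e0', e0'] at this
    have haw := hvel hca hcw ha
    simp [haw, hb, hd] at this
  have some_zero : a₁ ⬝ᵥ v = 0 ∨ a₂ ⬝ᵥ v = 0 ∨ a₃ ⬝ᵥ v = 0 := by
    have := congrArg PowerSeries.constantCoeff hid
    rw [map_neg, map_mul, map_mul, map_mul, e0', e0', e0', e0', hcv, zero_mul, neg_eq_zero] at this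
    simpa [or_assoc] using this
  by_cases z₁ : a₁ ⬝ᵥ v = 0 <;> by_cases z₂ : a₂ ⬝ᵥ v = 0 <;> by_cases z₃ : a₃ ⬝ᵥ v = 0
  · exact multi (Or.inl ⟨z₁, z₂⟩)
  · exact multi (Or.inl ⟨z₁, z₂⟩)
  · exact multi (Or.inr (Or.inl ⟨z₁, z₃⟩))
  · rw [if_pos ((hiff i₁ hp h₁).mpr z₁), if_neg (mt (hiff i₂ hq h₂).mp z₂),
      if_neg (mt (hiff i₃ hr h₃).mp z₃), single i₁ z₁ z₂ z₃ (by rw [← hid]; ring)]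
  · exact multi (Or.inr (Or.inr ⟨z₂, z₃⟩))
  · rw [if_neg (mt (hiff i₁ hp h₁).mp z₁), if_pos ((hiff i₂ hq h₂).mpr z₂),
      if_neg (mt (hiff i₃ hr h₃).mp z₃), single i₂ z₂ z₁ z₃ (by rw [← hid]; ring)]
  · rw [if_neg (mt (hiff i₁ hp h₁).mp z₁), if_neg (mt (hiff i₂ hq h₂).mp z₂),
      if_pos ((hiff i₃ hr h₃).mpr z₃), single i₃ z₃ z₁ z₂ (by rw [← hid]; ring)]
  · simp [z₁, z₂, z₃] at some_zero

open Classical in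
/-- The divisor of a quotient of products of two linear forms on a nonsingular cubic. -/
theorem hasDivisor_of_isLineSection {F : MvPolynomial (Fin 3) ℂ} (hF : F.IsHomogeneous 3)
    (hs : IsNonsingular F) (hF0 : F ≠ 0) {a b c d : Fin 3 → ℂ}
    {p₁ p₂ p₃ q₁ q₂ q₃ r₁ r₂ r₃ s₁ s₂ s₃ : PlanePt}
    (ha : IsLineSection F a p₁ p₂ p₃) (hb : IsLineSection F b q₁ q₂ q₃)
    (hc : IsLineSection F c r₁ r₂ r₃) (hd : IsLineSection F d s₁ s₂ s₃) :
    HasDivisor F (linForm a * linForm b) (linForm c * linForm d)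
      (triple p₁ p₂ p₃ + triple q₁ q₂ q₃ - triple r₁ r₂ r₃ - triple s₁ s₂ s₃) := by
  have hdeg : ∀ {a b : Fin 3 → ℂ}, a ≠ 0 → b ≠ 0 → ¬ F ∣ linForm a * linForm b := by
    intro a b ha hb hdvd
    have h2 := ((isHomogeneous_linForm a).mul (isHomogeneous_linForm b)).totalDegree_le
    have h3 := totalDegree_le_of_dvd_of_isDomain hdvd
      (mul_ne_zero (linForm_ne_zero ha) (linForm_ne_zero hb))
    rw [hF.totalDegree hF0] at h3
    lia
  refine ⟨⟨2, (isHomogeneous_linForm a).mul (isHomogeneous_linForm b),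
    (isHomogeneous_linForm c).mul (isHomogeneous_linForm d)⟩, hdeg ha.1 hb.1, hdeg hc.1 hd.1,
    ?_, ?_⟩
  · intro x hx
    have hno : ∀ {a : Fin 3 → ℂ} {p q r : PlanePt}, IsLineSection F a p q r →
        (triple p q r) x = 0 := by
      intro a p q r h
      obtain ⟨h1, h2, h3⟩ := h.vanishesAt
      have : p ≠ x ∧ q ≠ x ∧ r ≠ x :=
        ⟨fun e => hx (e ▸ h1), fun e => hx (e ▸ h2), fun e => hx (e ▸ h3)⟩
      simp [triple, this]
    simp [hno ha, hno hb, hno hc, hno hd]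
  · intro x γ hγ
    have hord : ∀ {a b : Fin 3 → ℂ} {p₁ p₂ p₃ q₁ q₂ q₃ : PlanePt}, IsLineSection F a p₁ p₂ p₃ →
        IsLineSection F b q₁ q₂ q₃ → ∃ m : ℕ,
          (aeval γ (linForm a * linForm b) : PowerSeries ℂ).order = m ∧
          (m : ℤ) = (triple p₁ p₂ p₃ + triple q₁ q₂ q₃) x := by
      intro a b p₁ p₂ p₃ q₁ q₂ q₃ ha hb
      rw [map_mul, PowerSeries.order_mul, ha.order_eq hF hs hγ, hb.order_eq hF hs hγ,
        ← Nat.cast_add]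
      refine ⟨_, rfl, ?_⟩
      simp only [Finsupp.add_apply, triple, Finsupp.single_apply]
      push_cast
      rfl
    obtain ⟨m, hm, hm'⟩ := hord ha hb
    obtain ⟨n, hn, hn'⟩ := hord hc hd
    refine ⟨m, n, hm, hn, ?_⟩
    rw [hm', hn', sub_sub, Finsupp.sub_apply]

/-! ### The matrix pencil -/

/-- The matrix `λ + μ A + ν B` at the point with coordinates `x = (λ, μ, ν)`. -/
def pencil (A B : Matrix (Fin 3) (Fin 3) ℂ) (x : Fin 3 → ℂ) : Matrix (Fin 3) (Fin 3) ℂ :=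
  x 0 • (1 : Matrix (Fin 3) (Fin 3) ℂ) + x 1 • A + x 2 • B

theorem eval_spectralCubic (A B : Matrix (Fin 3) (Fin 3) ℂ) (x : Fin 3 → ℂ) :
    eval x (spectralCubic A B) = (pencil A B x).det := by
  rw [spectralCubic, RingHom.map_det]
  congr 1
  ext i j
  by_cases hij : i = j <;> simp [pencil, hij]

theorem isHomogeneous_spectralCubic (A B : Matrix (Fin 3) (Fin 3) ℂ) :
    (spectralCubic A B).IsHomogeneous 3 := by
  rw [spectralCubic]
  set N : Matrix (Fin 3) (Fin 3) (MvPolynomial (Fin 3) ℂ) := (X 0 : MvPolynomial (Fin 3) ℂ) •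
    (1 : Matrix (Fin 3) (Fin 3) (MvPolynomial (Fin 3) ℂ))
      + (X 1 : MvPolynomial (Fin 3) ℂ) • A.map C + (X 2 : MvPolynomial (Fin 3) ℂ) • B.map C with hN
  have hent : ∀ i j, (N i j).IsHomogeneous 1 := by
    intro i j
    simp only [hN, Matrix.add_apply, Matrix.smul_apply, Matrix.map_apply, smul_eq_mul]
    refine ((IsHomogeneous.add ?_ ?_).add ?_)
    · rw [Matrix.one_apply]
      split_ifs
      · simpa using isHomogeneous_X ℂ (0 : Fin 3)
      · simpa using isHomogeneous_zero (Fin 3) ℂ 1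
    · exact (isHomogeneous_X ℂ 1).mul (isHomogeneous_C _ _)
    · exact (isHomogeneous_X ℂ 2).mul (isHomogeneous_C _ _)
  rw [Matrix.det_fin_three]
  have h3 : ∀ i j k l m n, (N i j * N k l * N m n).IsHomogeneous 3 :=
    fun i j k l m n => ((hent i j).mul (hent k l)).mul (hent m n)
  exact (((((h3 _ _ _ _ _ _).sub (h3 _ _ _ _ _ _)).sub (h3 _ _ _ _ _ _)).add
    (h3 _ _ _ _ _ _)).add (h3 _ _ _ _ _ _)).sub (h3 _ _ _ _ _ _)

theorem spectralCubic_ne_zero (A B : Matrix (Fin 3) (Fin 3) ℂ) : spectralCubic A B ≠ 0 := by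
  intro h
  have := congrArg (eval ![1, 0, 0]) h
  simp [eval_spectralCubic, pencil] at this

theorem spectralCubic_swap (A B : Matrix (Fin 3) (Fin 3) ℂ) :
    spectralCubic B A = swapPoly (spectralCubic A B) := by
  apply MvPolynomial.funext
  intro x
  rw [swapPoly, eval_rename, eval_spectralCubic, eval_spectralCubic]
  congr 1
  simp only [pencil, Function.comp]
  rw [show Equiv.swap (1 : Fin 3) 2 0 = 0 by decide, show Equiv.swap (1 : Fin 3) 2 1 = 2 by decide,
    show Equiv.swap (1 : Fin 3) 2 2 = 1 by decide]
  abel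

theorem spectralCubic_conj {A B A' B' : Matrix (Fin 3) (Fin 3) ℂ} (m : GL (Fin 3) ℂ)
    (hA : (m : Matrix (Fin 3) (Fin 3) ℂ) * A * (m⁻¹ : GL (Fin 3) ℂ) = A')
    (hB : (m : Matrix (Fin 3) (Fin 3) ℂ) * B * (m⁻¹ : GL (Fin 3) ℂ) = B') :
    spectralCubic A' B' = spectralCubic A B := by
  apply MvPolynomial.funext
  intro x
  rw [eval_spectralCubic, eval_spectralCubic]
  have : pencil A' B' x = (m : Matrix (Fin 3) (Fin 3) ℂ) * pencil A B x * (m⁻¹ : GL (Fin 3) ℂ) := by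
    simp only [pencil, ← hA, ← hB, mul_add, add_mul, Matrix.mul_smul, Matrix.smul_mul, mul_one]
    rw [Units.mul_inv]
  rw [this]
  exact Matrix.det_units_conj m _

theorem vecMul_pencil (A B : Matrix (Fin 3) (Fin 3) ℂ) (x z : Fin 3 → ℂ) :
    z ᵥ* pencil A B x = x 0 • z + x 1 • (z ᵥ* A) + x 2 • (z ᵥ* B) := by
  simp [pencil, vecMul_add, vecMul_smul]

theorem triple_product_vecMul (N : Matrix (Fin 3) (Fin 3) ℂ) (a b c : Fin 3 → ℂ) :
    (a ᵥ* N) ⬝ᵥ (b ᵥ* N) ⨯₃ (c ᵥ* N) = N.det * (a ⬝ᵥ b ⨯₃ c) := by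
  rw [triple_product_eq_det, triple_product_eq_det, mul_comm]
  refine Eq.trans ?_ (Matrix.det_mul (Matrix.of ![a, b, c]) N)
  congr 1
  ext i j
  fin_cases i <;> simp [Matrix.mul_apply, vecMul, dotProduct]

/-- The coefficients of the linear form `x ↦ a ⬝ᵥ b ⨯₃ (z ᵥ* pencil A B x)`. -/
def pencilForm (A B : Matrix (Fin 3) (Fin 3) ℂ) (a b z : Fin 3 → ℂ) : Fin 3 → ℂ :=
  ![a ⬝ᵥ b ⨯₃ z, a ⬝ᵥ b ⨯₃ (z ᵥ* A), a ⬝ᵥ b ⨯₃ (z ᵥ* B)]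

theorem pencilForm_dotProduct (A B : Matrix (Fin 3) (Fin 3) ℂ) (a b z x : Fin 3 → ℂ) :
    pencilForm A B a b z ⬝ᵥ x = a ⬝ᵥ b ⨯₃ (z ᵥ* pencil A B x) := by
  rw [vecMul_pencil, vec3_dotProduct]
  simp [pencilForm, dotProduct_add]
  ring

theorem pencilForm_dotProduct_eq_zero {A B : Matrix (Fin 3) (Fin 3) ℂ} {a b z x v : Fin 3 → ℂ}
    (hv : v ≠ 0) (hx : pencil A B x *ᵥ v = 0) (ha : a ⬝ᵥ v = 0) (hb : b ⬝ᵥ v = 0) :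
    pencilForm A B a b z ⬝ᵥ x = 0 := by
  rw [pencilForm_dotProduct]
  refine dotProduct_cross_eq_zero_of_common hv ha hb ?_
  rw [← dotProduct_mulVec, hx, dotProduct_zero]

theorem linearIndependent_of_triple_product_ne_zero {a b c : Fin 3 → ℂ} (h : a ⬝ᵥ b ⨯₃ c ≠ 0) :
    LinearIndependent ℂ ![a, b] := by
  rw [← crossProduct_ne_zero_iff_linearIndependent]
  intro h0
  apply h
  rw [triple_product_permutation, triple_product_permutation, h0, dotProduct_zero]

/-- A Plücker relation: if `n` is a combination of `e` and `b`, both sides are computed by expanding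
`n` and `p • e + ν • b` in `e` and `b`. -/
theorem triple_product_exchange {e b n : Fin 3 → ℂ} (hn : e ⬝ᵥ b ⨯₃ n = 0) (p ν : ℂ)
    (f w : Fin 3 → ℂ) :
    ((p • e + ν • b) ⬝ᵥ n ⨯₃ w) * (e ⬝ᵥ b ⨯₃ f)
      = -((f ⬝ᵥ n ⨯₃ (p • e + ν • b)) * (e ⬝ᵥ b ⨯₃ w)) := by
  simp only [cross_apply, vec3_dotProduct, Pi.add_apply, Pi.smul_apply, smul_eq_mul,
    Matrix.cons_val] at hn ⊢
  -- in general the sides differ by `e ⬝ᵥ b ⨯₃ n` times `f ⬝ᵥ (p • e + ν • b) ⨯₃ w`, up to sign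
  linear_combination (-(f 0 * ((p * e 1 + ν * b 1) * w 2 - (p * e 2 + ν * b 2) * w 1)
    + f 1 * ((p * e 2 + ν * b 2) * w 0 - (p * e 0 + ν * b 0) * w 2)
    + f 2 * ((p * e 0 + ν * b 0) * w 1 - (p * e 1 + ν * b 1) * w 0))) * hn

/-- The companion of `triple_product_exchange` for `f` a combination of `e` and `b`. -/
theorem triple_product_exchange_of_mem {e b f : Fin 3 → ℂ} (hf : e ⬝ᵥ b ⨯₃ f = 0) (p ν : ℂ)
    (k w : Fin 3 → ℂ) :
    ((p • e + ν • b) ⬝ᵥ f ⨯₃ w) * (e ⬝ᵥ f ⨯₃ k)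
      = (f ⬝ᵥ k ⨯₃ (p • e + ν • b)) * (e ⬝ᵥ f ⨯₃ w) := by
  simp only [cross_apply, vec3_dotProduct, Pi.add_apply, Pi.smul_apply, smul_eq_mul,
    Matrix.cons_val] at hf ⊢
  -- in general the sides differ by `e ⬝ᵥ b ⨯₃ f` times `ν * (f ⬝ᵥ w ⨯₃ k)`, up to sign
  linear_combination (-ν * (f 0 * (w 1 * k 2 - w 2 * k 1) + f 1 * (w 2 * k 0 - w 0 * k 2)
    + f 2 * (w 0 * k 1 - w 1 * k 0))) * hf

/-! ### The two lines -/

/-- The spectral curve of `(A, B)` contains no line. -/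
def NoLine (A B : Matrix (Fin 3) (Fin 3) ℂ) : Prop :=
  ∀ c : Fin 3 → ℂ, c ≠ 0 → ∃ x, c ⬝ᵥ x = 0 ∧ (pencil A B x).det ≠ 0

theorem IsNonsingular.noLine {A B : Matrix (Fin 3) (Fin 3) ℂ}
    (hs : IsNonsingular (spectralCubic A B)) : NoLine A B := by
  intro c hc
  have := hs.not_linForm_dvd (isHomogeneous_spectralCubic A B) (by norm_num) hc
  rw [linForm_dvd_iff_eval hc] at this
  push Not at this
  simpa only [eval_spectralCubic] using this

/-- Left eigenvectors `e` of `A` and `f` of `B` such that `e`, `e B`, `e B A` are independent, as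
are `f`, `f A`, `f A B`. -/
structure IsEigenpair (A B : Matrix (Fin 3) (Fin 3) ℂ) (e f : Fin 3 → ℂ) (a b : ℂ) : Prop where
  left : e ᵥ* A = a • e
  right : f ᵥ* B = b • f
  cyclic_left : e ⬝ᵥ (e ᵥ* B) ⨯₃ ((e ᵥ* B) ᵥ* A) ≠ 0
  cyclic_right : f ⬝ᵥ (f ᵥ* A) ⨯₃ ((f ᵥ* A) ᵥ* B) ≠ 0

namespace IsEigenpair

variable {A B : Matrix (Fin 3) (Fin 3) ℂ} {e f : Fin 3 → ℂ} {a b : ℂ}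

theorem symm (h : IsEigenpair A B e f a b) : IsEigenpair B A f e b a :=
  ⟨h.right, h.left, h.cyclic_right, h.cyclic_left⟩

theorem vecMul_left (h : IsEigenpair A B e f a b) (x : Fin 3 → ℂ) :
    e ᵥ* pencil A B x = (x 0 + x 1 * a) • e + x 2 • (e ᵥ* B) := by
  rw [vecMul_pencil, h.left, add_smul, smul_smul]

theorem vecMul_right (h : IsEigenpair A B e f a b) (x : Fin 3 → ℂ) :
    f ᵥ* pencil A B x = (x 0 + x 2 * b) • f + x 1 • (f ᵥ* A) := by
  rw [vecMul_pencil, h.right, add_smul, smul_smul, add_right_comm]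

theorem linearIndependent_left (h : IsEigenpair A B e f a b) :
    LinearIndependent ℂ ![e, e ᵥ* B] :=
  linearIndependent_of_triple_product_ne_zero h.cyclic_left

theorem linearIndependent (h : IsEigenpair A B e f a b) : LinearIndependent ℂ ![e, f] := by
  have he : e ≠ 0 := h.linearIndependent_left.ne_zero 0
  have hf : f ≠ 0 := h.symm.linearIndependent_left.ne_zero 0
  rw [LinearIndependent.pair_iff' he]
  rintro t rfl
  have ht : t ≠ 0 := fun h0 => hf (by rw [h0, zero_smul])
  refine (LinearIndependent.pair_iff' he).mp h.linearIndependent_left b ?_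
  have := h.right
  rw [smul_vecMul, smul_comm b t] at this
  exact (smul_right_injective _ ht this).symm

end IsEigenpair

/-- The coefficients of the line through `X₁` and the distinguished point. On the line the rows
`e`, `e B` and `f N` are dependent, where `N` is the matrix `λ + μ A + ν B`. -/
def lineX (A B : Matrix (Fin 3) (Fin 3) ℂ) (e f : Fin 3 → ℂ) : Fin 3 → ℂ :=
  pencilForm A B e (e ᵥ* B) f

/-- The coefficients of the line through `P₁` and the distinguished point of `(B, A)`, in the
coordinates of the spectral curve of `(A, B)`. -/
def lineP (A B : Matrix (Fin 3) (Fin 3) ℂ) (e f : Fin 3 → ℂ) : Fin 3 → ℂ :=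
  pencilForm A B f (f ᵥ* A) e

namespace IsEigenpair

variable {A B : Matrix (Fin 3) (Fin 3) ℂ} {e f : Fin 3 → ℂ} {a b : ℂ}

/-- On the line `lineX`, off the case where `lineX` is proportional to `μ`, the cubic is a product
of `μ`, `lineP` and a form vanishing at the distinguished point. -/
theorem det_pencil_of_lineX (h : IsEigenpair A B e f a b) {x : Fin 3 → ℂ}
    (hx : lineX A B e f ⬝ᵥ x = 0) :
    (pencil A B x).det * lineX A B e f 0 ^ 2
      = x 1 * (pencilForm A B e (e ᵥ* B) (e ᵥ* B) ⬝ᵥ x) * (lineP A B e f ⬝ᵥ x) := by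
  rw [lineX, pencilForm_dotProduct] at hx
  have h1 := triple_product_exchange hx (x 0 + x 1 * a) (x 2) f ((e ᵥ* B) ᵥ* pencil A B x)
  rw [← h.vecMul_left, triple_product_vecMul, h.vecMul_right] at h1
  have h2 : f ⬝ᵥ ((x 0 + x 2 * b) • f + x 1 • (f ᵥ* A)) ⨯₃ (e ᵥ* pencil A B x)
      = x 1 * (lineP A B e f ⬝ᵥ x) := by
    rw [lineP, pencilForm_dotProduct]
    simp
  have h3 : e ⬝ᵥ f ⨯₃ (e ᵥ* B) = -(e ⬝ᵥ (e ᵥ* B) ⨯₃ f) := by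
    rw [← cross_anticomm, dotProduct_neg]
  rw [h2, h3] at h1
  have h4 : lineX A B e f 0 = e ⬝ᵥ (e ᵥ* B) ⨯₃ f := rfl
  rw [h4, pencilForm_dotProduct]
  linear_combination -h1

/-- If `lineX` is proportional to `μ`, the cubic is on this line a product of `λ + b ν`, `lineP` and
a form vanishing at the distinguished point. -/
theorem det_pencil_of_lineX_eq_zero (h : IsEigenpair A B e f a b) (h0 : lineX A B e f 0 = 0)
    {x : Fin 3 → ℂ} (hx : x 1 = 0) :
    (pencil A B x).det * lineP A B e f 0 ^ 2
      = (x 0 + x 2 * b) * (pencilForm A B e f (f ᵥ* A) ⬝ᵥ x) * (lineP A B e f ⬝ᵥ x) := by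
  have h0' : e ⬝ᵥ (e ᵥ* B) ⨯₃ f = 0 := h0
  have h1 := triple_product_exchange_of_mem h0' (x 0 + x 1 * a) (x 2) (f ᵥ* A)
    ((f ᵥ* A) ᵥ* pencil A B x)
  rw [← h.vecMul_left] at h1
  have h2 := triple_product_vecMul (pencil A B x) e f (f ᵥ* A)
  rw [h.vecMul_right, hx, zero_smul, add_zero, map_smul, LinearMap.smul_apply,
    dotProduct_smul, smul_eq_mul] at h2
  have h4 : lineP A B e f 0 = e ⬝ᵥ f ⨯₃ (f ᵥ* A) := (triple_product_permutation _ _ _).symm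
  rw [lineP] at h4 ⊢
  rw [h4, pencilForm_dotProduct, pencilForm_dotProduct]
  linear_combination (-(e ⬝ᵥ f ⨯₃ (f ᵥ* A))) * h2 + (x 0 + x 2 * b) * h1

/-- The coefficients of `λ` in both lines vanish only if the span of `e` and `f` is invariant under
`A` and `B`; then the cubic is reducible. -/
theorem lineX_ne_zero_or_lineP_ne_zero (h : IsEigenpair A B e f a b)
    (hs : NoLine A B) : lineX A B e f 0 ≠ 0 ∨ lineP A B e f 0 ≠ 0 := by
  by_contra! hne
  obtain ⟨hX, hP⟩ := hne
  have hX' : e ⬝ᵥ (e ᵥ* B) ⨯₃ f = 0 := hX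
  have hP' : f ⬝ᵥ (f ᵥ* A) ⨯₃ e = 0 := hP
  have hli := h.linearIndependent
  set v := e ⨯₃ f with hv
  have hv0 : v ≠ 0 := crossProduct_ne_zero_iff_linearIndependent.mpr hli
  have hev : e ⬝ᵥ v = 0 := dot_self_cross e f
  have hfv : f ⬝ᵥ v = 0 := dot_cross_self e f
  have hBv : (e ᵥ* B) ⬝ᵥ v = 0 := by
    rw [hv, ← cross_anticomm, dotProduct_neg, ← triple_product_permutation, hX', neg_zero]
  have hAv : (f ᵥ* A) ⬝ᵥ v = 0 := by
    rw [hv, ← triple_product_permutation, hP']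
  obtain ⟨s, hs'⟩ := exists_smul_of_dotProduct_eq_zero (w := A *ᵥ v) hli hv0 hev hfv
    (by rw [dotProduct_mulVec, h.left, smul_dotProduct, hev, smul_zero])
    (by rw [dotProduct_mulVec, hAv])
  obtain ⟨t, ht'⟩ := exists_smul_of_dotProduct_eq_zero (w := B *ᵥ v) hli hv0 hev hfv
    (by rw [dotProduct_mulVec, hBv])
    (by rw [dotProduct_mulVec, h.right, smul_dotProduct, hfv, smul_zero])
  have hc : (![1, s, t] : Fin 3 → ℂ) ≠ 0 := fun h0 => one_ne_zero (congrFun h0 0)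
  obtain ⟨x, hx, hdet⟩ := hs _ hc
  refine hdet ?_
  refine Matrix.exists_mulVec_eq_zero_iff.mp ⟨v, hv0, ?_⟩
  have : pencil A B x *ᵥ v = (![1, s, t] ⬝ᵥ x) • v := by
    rw [pencil, add_mulVec, add_mulVec, smul_mulVec, smul_mulVec, smul_mulVec, hs', ht',
      vec3_dotProduct, one_mulVec, smul_smul, smul_smul, ← add_smul, ← add_smul]
    simp [mul_comm]
  rw [this, hx, zero_smul]

theorem lineX_ne_zero (h : IsEigenpair A B e f a b) (hs : NoLine A B) :
    lineX A B e f ≠ 0 := by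
  intro h0
  have h1 : e ⬝ᵥ (e ᵥ* B) ⨯₃ f = 0 := congrFun h0 0
  have h2 : e ⬝ᵥ (e ᵥ* B) ⨯₃ (f ᵥ* A) = 0 := congrFun h0 1
  refine (h.lineX_ne_zero_or_lineP_ne_zero hs).elim (fun h => h h1) (fun h' => h' ?_)
  refine dotProduct_cross_eq_zero_of_common
    (crossProduct_ne_zero_iff_linearIndependent.mpr h.linearIndependent_left) ?_ ?_ ?_
  · rw [← h1, triple_product_permutation, triple_product_permutation]
  · rw [← h2, triple_product_permutation, triple_product_permutation]
  · exact dot_self_cross _ _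

/-- If the lines coincided, the factorization of the cubic on `lineX` would contain a factor that
vanishes on the line. -/
theorem linearIndependent_lines (h : IsEigenpair A B e f a b)
    (hs : NoLine A B) (hX : lineX A B e f ≠ 0) :
    LinearIndependent ℂ ![lineX A B e f, lineP A B e f] := by
  rw [LinearIndependent.pair_iff' hX]
  intro s hsl
  have h0 : lineX A B e f 0 ≠ 0 := by
    intro h0
    refine (h.lineX_ne_zero_or_lineP_ne_zero hs).elim (fun h => h h0) (fun h' => h' ?_)
    rw [← hsl, Pi.smul_apply, h0, smul_zero]
  obtain ⟨x, hx, hdet⟩ := hs _ hX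
  have := h.det_pencil_of_lineX hx
  rw [← hsl, smul_dotProduct, hx, smul_zero, mul_zero] at this
  exact hdet ((mul_eq_zero.mp this).resolve_right (pow_ne_zero 2 h0))

end IsEigenpair

theorem linearIndependent_of_apply_eq_zero {c d : Fin 3 → ℂ} {i : Fin 3} (hc : c i ≠ 0)
    (hd : d ≠ 0) (hdi : d i = 0) : LinearIndependent ℂ ![c, d] := by
  rw [LinearIndependent.pair_iff]
  intro s t hst
  have h1 := congrFun hst i
  simp only [Pi.add_apply, Pi.smul_apply, smul_eq_mul, hdi, mul_zero, add_zero, Pi.zero_apply,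
    mul_eq_zero, hc, or_false] at h1
  subst h1
  rw [zero_smul, zero_add] at hst
  exact ⟨rfl, (smul_eq_zero.mp hst).resolve_right hd⟩

theorem linearIndependent_of_apply_ne_zero {c d : Fin 3 → ℂ} {i : Fin 3} (hc : c ≠ 0)
    (hci : c i = 0) (hd : d i ≠ 0) : LinearIndependent ℂ ![c, d] :=
  LinearIndependent.pair_symm_iff.mp (linearIndependent_of_apply_eq_zero hd hc hci)

/-- A vector `v` with `e ⬝ᵥ v = 0` in the kernel of the pencil at a point `q` with `ν = 1`: this
characterizes the distinguished point. -/
structure IsKernelPoint (A B : Matrix (Fin 3) (Fin 3) ℂ) (e q v : Fin 3 → ℂ) : Prop where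
  ne_zero : v ≠ 0
  dot_left : e ⬝ᵥ v = 0
  mulVec : pencil A B q *ᵥ v = 0
  last : q 2 = 1

namespace IsEigenpair

variable {A B : Matrix (Fin 3) (Fin 3) ℂ} {e f : Fin 3 → ℂ} {a b : ℂ}

theorem dot_vecMul (h : IsEigenpair A B e f a b) {q v : Fin 3 → ℂ}
    (hq : IsKernelPoint A B e q v) : (e ᵥ* B) ⬝ᵥ v = 0 := by
  have := h.vecMul_left q
  have h2 : (e ᵥ* pencil A B q) ⬝ᵥ v = 0 := by
    rw [← dotProduct_mulVec, hq.mulVec, dotProduct_zero]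
  rwa [this, add_dotProduct, smul_dotProduct, hq.dot_left, smul_zero, zero_add, hq.last,
    one_smul] at h2

theorem lineX_dotProduct_kernelPoint (h : IsEigenpair A B e f a b) {q v : Fin 3 → ℂ}
    (hq : IsKernelPoint A B e q v) : lineX A B e f ⬝ᵥ q = 0 :=
  pencilForm_dotProduct_eq_zero hq.ne_zero hq.mulVec hq.dot_left (h.dot_vecMul hq)

theorem lineX_dotProduct_pointX (h : IsEigenpair A B e f a b) :
    lineX A B e f ⬝ᵥ ![b, 0, -1] = 0 := by
  simp [lineX, pencilForm, h.right, vec3_dotProduct]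
  ring

/-- On `lineX` the cubic is a product of forms vanishing at `X₁`, at the distinguished point, and
the form `lineP`. -/
theorem exists_factors (h : IsEigenpair A B e f a b) (hs : NoLine A B)
    {q v : Fin 3 → ℂ} (hq : IsKernelPoint A B e q v) :
    ∃ a₁ a₂ : Fin 3 → ℂ, LinearIndependent ℂ ![lineX A B e f, a₁] ∧
      LinearIndependent ℂ ![lineX A B e f, a₂] ∧ a₁ ⬝ᵥ ![b, 0, -1] = 0 ∧ a₂ ⬝ᵥ q = 0 ∧
      ∀ x, lineX A B e f ⬝ᵥ x = 0 →
        (pencil A B x).det = (a₁ ⬝ᵥ x) * (a₂ ⬝ᵥ x) * (lineP A B e f ⬝ᵥ x) := by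
  by_cases h0 : lineX A B e f 0 = 0
  -- the line is `μ = 0`
  · have hP : lineP A B e f 0 ≠ 0 :=
      (h.lineX_ne_zero_or_lineP_ne_zero hs).resolve_left fun h' => h' h0
    have h0' : e ⬝ᵥ (e ᵥ* B) ⨯₃ f = 0 := h0
    have hX := h.lineX_ne_zero hs
    have hX2 : lineX A B e f 2 = 0 := by
      change e ⬝ᵥ (e ᵥ* B) ⨯₃ (f ᵥ* B) = 0
      rw [h.right, map_smul, dotProduct_smul, h0', smul_zero]
    have hX1 : lineX A B e f 1 ≠ 0 := by
      intro h1
      refine hX ?_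
      ext i
      fin_cases i
      exacts [h0, h1, hX2]
    have hfv : f ⬝ᵥ v = 0 := by
      obtain ⟨s, t, rfl⟩ := exists_combination (b := f) h.linearIndependent_left
        (by rw [← h0', triple_product_permutation])
      rw [add_dotProduct, smul_dotProduct, smul_dotProduct, hq.dot_left, h.dot_vecMul hq]
      simp
    refine ⟨((lineP A B e f 0 ^ 2)⁻¹) • ![1, 0, b], pencilForm A B e f (f ᵥ* A),
      linearIndependent_of_apply_ne_zero (i := 0) hX h0 (by simpa using hP),
      linearIndependent_of_apply_ne_zero (i := 0) hX h0 ?_, by simp,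
      pencilForm_dotProduct_eq_zero hq.ne_zero hq.mulVec hq.dot_left hfv, ?_⟩
    · change e ⬝ᵥ f ⨯₃ (f ᵥ* A) ≠ 0
      rw [triple_product_permutation]
      exact hP
    · intro x hx
      have hx1 : x 1 = 0 := by
        rw [vec3_dotProduct, h0, hX2] at hx
        simpa [hX1] using hx
      have key := h.det_pencil_of_lineX_eq_zero h0 hx1
      rw [smul_dotProduct, smul_eq_mul, vec3_dotProduct ![1, 0, b] x]
      simp only [Matrix.cons_val]
      field_simp
      rw [key]
      ring
  · refine ⟨((lineX A B e f 0 ^ 2)⁻¹) • ![0, 1, 0], pencilForm A B e (e ᵥ* B) (e ᵥ* B),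
      linearIndependent_of_apply_eq_zero (i := 0) h0 ?_ (by simp),
      linearIndependent_of_apply_eq_zero (i := 0) h0 ?_ ?_, by simp,
      pencilForm_dotProduct_eq_zero hq.ne_zero hq.mulVec hq.dot_left (h.dot_vecMul hq), ?_⟩
    · intro h1
      have := congrFun h1 1
      simp [h0] at this
    · exact fun h1 => h.cyclic_left (congrFun h1 1)
    · simp [pencilForm]
    · intro x hx
      have key := h.det_pencil_of_lineX hx
      rw [smul_dotProduct, smul_eq_mul, vec3_dotProduct ![0, 1, 0] x]
      simp only [Matrix.cons_val]
      field_simp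
      rw [key]
      ring

end IsEigenpair

/-! ### Exchanging the two matrices -/

/-- The transposition `(λ, μ, ν) ↦ (λ, ν, μ)` of coordinates. -/
def swapVec (x : Fin 3 → ℂ) : Fin 3 → ℂ := ![x 0, x 2, x 1]

theorem swapVec_swapVec (x : Fin 3 → ℂ) : swapVec (swapVec x) = x := by
  ext i
  fin_cases i <;> rfl

theorem swapVec_dotProduct (c x : Fin 3 → ℂ) : swapVec c ⬝ᵥ x = c ⬝ᵥ swapVec x := by
  simp only [swapVec, vec3_dotProduct, Matrix.cons_val]
  ring

theorem pencil_swapVec (A B : Matrix (Fin 3) (Fin 3) ℂ) (x : Fin 3 → ℂ) :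
    pencil B A (swapVec x) = pencil A B x := by
  simp only [pencil, swapVec, Matrix.cons_val]
  abel

theorem swapVec_ne_zero {x : Fin 3 → ℂ} (hx : x ≠ 0) : swapVec x ≠ 0 := by
  rintro h
  apply hx
  rw [← swapVec_swapVec x, h]
  ext i
  fin_cases i <;> rfl

theorem linearIndependent_swapVec {c d : Fin 3 → ℂ} (h : LinearIndependent ℂ ![c, d]) :
    LinearIndependent ℂ ![swapVec c, swapVec d] := by
  rw [LinearIndependent.pair_iff] at h ⊢
  intro s t hst
  refine h s t ?_
  ext i
  have h0 := congrFun hst 0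
  have h1 := congrFun hst 1
  have h2 := congrFun hst 2
  fin_cases i
  exacts [h0, h2, h1]

theorem NoLine.symm {A B : Matrix (Fin 3) (Fin 3) ℂ} (h : NoLine A B) : NoLine B A := by
  intro c hc
  obtain ⟨x, hx, hdet⟩ := h (swapVec c) (swapVec_ne_zero hc)
  exact ⟨swapVec x, by rwa [← swapVec_dotProduct], by rwa [pencil_swapVec]⟩

theorem lineX_swap (A B : Matrix (Fin 3) (Fin 3) ℂ) (e f : Fin 3 → ℂ) :
    lineX B A f e = swapVec (lineP A B e f) := rfl

theorem lineP_swap (A B : Matrix (Fin 3) (Fin 3) ℂ) (e f : Fin 3 → ℂ) :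
    lineP B A f e = swapVec (lineX A B e f) := rfl

theorem swapPoint_mk {v : Fin 3 → ℂ} (hv : v ≠ 0) :
    swapPoint (Projectivization.mk ℂ v hv)
      = Projectivization.mk ℂ (swapVec v) (swapVec_ne_zero hv) := by
  have : (LinearEquiv.funCongrLeft ℂ ℂ (Equiv.swap (1 : Fin 3) 2)).toLinearMap v = swapVec v := by
    ext i
    fin_cases i <;> rfl
  simp only [swapPoint, Projectivization.map_mk, this]

/-! ### The line sections of the spectral cubic -/

namespace IsEigenpair

variable {A B : Matrix (Fin 3) (Fin 3) ℂ} {e f : Fin 3 → ℂ} {a b : ℂ}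

/-- The lines `lineX` and `lineP` cut out `X₁ + Q + T` and `P₁ + T + Y`, where `T` is their common
point and `Y` is the distinguished point of `(B, A)` with transposed coordinates. -/
theorem exists_line_sections (h : IsEigenpair A B e f a b)
    (hs : NoLine A B) {q v r w : Fin 3 → ℂ}
    (hq : IsKernelPoint A B e q v) (hr : IsKernelPoint B A f r w) (hq0 : q ≠ 0) (hr0 : r ≠ 0) :
    ∃ T : PlanePt,
      IsLineSection (spectralCubic A B) (lineX A B e f) (pointX b) (Projectivization.mk ℂ q hq0) T ∧
      IsLineSection (spectralCubic A B) (lineP A B e f) (pointP a) T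
        (swapPoint (Projectivization.mk ℂ r hr0)) := by
  have hX := h.lineX_ne_zero hs
  have hli := h.linearIndependent_lines hs hX
  have hT : lineX A B e f ⨯₃ lineP A B e f ≠ 0 :=
    crossProduct_ne_zero_iff_linearIndependent.mpr hli
  refine ⟨Projectivization.mk ℂ _ hT, ?_, ?_⟩
  · obtain ⟨a₁, a₂, i₁, i₂, h₁, h₂, hdet⟩ := h.exists_factors hs hq
    exact IsLineSection.of_eval _ hq0 hT h.lineX_dotProduct_pointX
      (h.lineX_dotProduct_kernelPoint hq) (dot_self_cross _ _) i₁ i₂ hli h₁ h₂ (dot_cross_self _ _)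
      fun x hx => by rw [eval_spectralCubic, hdet x hx]
  · obtain ⟨a₁, a₂, i₁, i₂, h₁, h₂, hdet⟩ := h.symm.exists_factors hs.symm hr
    have hp := h.symm.lineX_dotProduct_pointX
    have hr' := h.symm.lineX_dotProduct_kernelPoint hr
    rw [lineX_swap] at i₁ i₂ hdet hp hr'
    have j₁ := linearIndependent_swapVec i₁
    have j₂ := linearIndependent_swapVec i₂
    rw [swapVec_swapVec] at j₁ j₂
    have hP : swapVec ![a, 0, -1] = ![a, -1, 0] := rfl
    rw [swapVec_dotProduct] at hp hr'
    rw [swapPoint_mk]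
    refine IsLineSection.of_eval (a₁ := swapVec a₁) (a₂ := lineX A B e f) (a₃ := swapVec a₂) _ hT
      (swapVec_ne_zero hr0) hp (dot_cross_self _ _) hr' j₁ (LinearIndependent.pair_symm_iff.mp hli)
      j₂ ?_ (dot_self_cross _ _) ?_ fun x hx => ?_
    · rwa [swapVec_dotProduct]
    · rwa [swapVec_dotProduct, swapVec_swapVec]
    · have := hdet (swapVec x) (by rwa [swapVec_dotProduct, swapVec_swapVec])
      rw [pencil_swapVec, lineP_swap] at this
      rw [eval_spectralCubic, this, swapVec_dotProduct, swapVec_dotProduct, swapVec_dotProduct,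
        swapVec_swapVec]
      ring

end IsEigenpair

theorem det_smul_one_add_smul {M : Matrix (Fin 3) (Fin 3) ℂ} {k : GL (Fin 3) ℂ} {ξ : Fin 3 → ℂ}
    (hk : M * (k : Matrix (Fin 3) (Fin 3) ℂ) = k.val * diagonal ξ) (s t : ℂ) :
    (s • (1 : Matrix (Fin 3) (Fin 3) ℂ) + t • M).det
      = (s + ξ 0 * t) * (s + ξ 1 * t) * (s + ξ 2 * t) := by
  have hd : diagonal (fun i => s + ξ i * t) = s • (1 : Matrix (Fin 3) (Fin 3) ℂ)
      + t • diagonal ξ := by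
    ext i j
    by_cases hij : i = j
    · subst hij
      simp [mul_comm]
    · simp [hij]
  have h : (s • (1 : Matrix (Fin 3) (Fin 3) ℂ) + t • M) * k.val
      = k.val * diagonal (fun i => s + ξ i * t) := by
    rw [hd, add_mul, mul_add, Matrix.smul_mul, Matrix.smul_mul, Matrix.mul_smul, Matrix.mul_smul,
      hk, one_mul, mul_one]
  have h' := congrArg Matrix.det h
  rw [det_mul, det_mul, det_diagonal, mul_comm, Fin.prod_univ_three] at h'
  exact mul_left_cancel₀ ((Matrix.isUnit_iff_isUnit_det _).mp k.isUnit).ne_zero h'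

theorem isLineSection_pointX {A B : Matrix (Fin 3) (Fin 3) ℂ} {k : GL (Fin 3) ℂ} {ξ : Fin 3 → ℂ}
    (hk : B * (k : Matrix (Fin 3) (Fin 3) ℂ) = (k : Matrix (Fin 3) (Fin 3) ℂ) * diagonal ξ) :
    IsLineSection (spectralCubic A B) ![0, 1, 0] (pointX (ξ 0)) (pointX (ξ 1)) (pointX (ξ 2)) := by
  have hli : ∀ t : ℂ, LinearIndependent ℂ ![![0, 1, 0], ![1, 0, t]] := fun t =>
    linearIndependent_of_apply_eq_zero (i := 1) (by simp) (fun h0 => one_ne_zero (congrFun h0 0))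
      (by simp)
  refine IsLineSection.of_eval (a₁ := ![1, 0, ξ 0]) (a₂ := ![1, 0, ξ 1]) (a₃ := ![1, 0, ξ 2])
    _ _ _ (by simp) (by simp) (by simp) (hli _) (hli _) (hli _) (by simp) (by simp) (by simp) ?_
  intro x hx
  have hx' : x 1 = 0 := by
    rw [vec3_dotProduct] at hx
    simpa using hx
  rw [eval_spectralCubic, pencil, hx', zero_smul, add_zero, det_smul_one_add_smul hk]
  simp only [vec3_dotProduct, Matrix.cons_val]
  ring

theorem isLineSection_pointP {A B : Matrix (Fin 3) (Fin 3) ℂ} {g : GL (Fin 3) ℂ} {h : Fin 3 → ℂ}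
    (hg : A * (g : Matrix (Fin 3) (Fin 3) ℂ) = (g : Matrix (Fin 3) (Fin 3) ℂ) * diagonal h) :
    IsLineSection (spectralCubic A B) ![0, 0, 1] (pointP (h 0)) (pointP (h 1)) (pointP (h 2)) := by
  have hli : ∀ t : ℂ, LinearIndependent ℂ ![![0, 0, 1], ![1, t, 0]] := fun t =>
    linearIndependent_of_apply_eq_zero (i := 2) (by simp) (fun h0 => one_ne_zero (congrFun h0 0))
      (by simp)
  refine IsLineSection.of_eval (a₁ := ![1, h 0, 0]) (a₂ := ![1, h 1, 0]) (a₃ := ![1, h 2, 0])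
    _ _ _ (by simp) (by simp) (by simp) (hli _) (hli _) (hli _) (by simp) (by simp) (by simp) ?_
  intro x hx
  have hx' : x 2 = 0 := by
    rw [vec3_dotProduct] at hx
    simpa using hx
  rw [eval_spectralCubic, pencil, hx', zero_smul, add_zero, det_smul_one_add_smul hg]
  simp only [vec3_dotProduct, Matrix.cons_val]
  ring

/-! ### The distinguished point in terms of an eigenframe -/

section Frame

variable {A B : Matrix (Fin 3) (Fin 3) ℂ} {g : GL (Fin 3) ℂ} {h : Fin 3 → ℂ}

/-- The rows of the inverse of an eigenbasis are left eigenvectors. -/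
theorem inv_row_vecMul (hg : A * (g : Matrix (Fin 3) (Fin 3) ℂ) = g.val * diagonal h) :
    (g⁻¹).val 0 ᵥ* A = h 0 • (g⁻¹).val 0 := by
  have h1 : (g⁻¹).val * A = diagonal h * (g⁻¹).val := by
    calc (g⁻¹).val * A = (g⁻¹).val * (A * g.val) * (g⁻¹).val := by
          rw [mul_assoc, mul_assoc, Units.mul_inv, mul_one]
      _ = diagonal h * (g⁻¹).val := by
          rw [hg, ← mul_assoc, Units.inv_mul, one_mul]
  have h2 := congrFun h1 0
  ext j
  have h3 := congrFun h2 j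
  rw [diagonal_mul] at h3
  exact h3

/-- With respect to the eigenbasis `g`, the rows `e`, `e B`, `e B A` have the matrix with rows
`(1, 0, 0)`, `(u₁₁, u₁₂, u₁₃)`, `(h₁ u₁₁, h₂ u₁₂, h₃ u₁₃)`. -/
theorem inv_row_cyclic (hg : A * (g : Matrix (Fin 3) (Fin 3) ℂ) = g.val * diagonal h)
    (hd : Function.Injective h) (h1 : ((g⁻¹).val * B * g.val) 0 1 ≠ 0)
    (h2 : ((g⁻¹).val * B * g.val) 0 2 ≠ 0) :
    (g⁻¹).val 0 ⬝ᵥ ((g⁻¹).val 0 ᵥ* B) ⨯₃ (((g⁻¹).val 0 ᵥ* B) ᵥ* A) ≠ 0 := by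
  set e := (g⁻¹).val 0
  set U := (g⁻¹).val * B * g.val with hU
  have r0 : e ᵥ* g.val = ![1, 0, 0] := by
    have := congrFun (Units.inv_mul g) 0
    refine Eq.trans this ?_
    ext i
    fin_cases i <;> rfl
  have r1 : (e ᵥ* B) ᵥ* g.val = U 0 := rfl
  have r2 : ((e ᵥ* B) ᵥ* A) ᵥ* g.val = ![U 0 0 * h 0, U 0 1 * h 1, U 0 2 * h 2] := by
    rw [vecMul_vecMul, hg, ← vecMul_vecMul, r1]
    ext i
    rw [vecMul_diagonal]
    fin_cases i <;> rfl
  intro h0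
  have := triple_product_vecMul g.val e (e ᵥ* B) ((e ᵥ* B) ᵥ* A)
  rw [h0, mul_zero, r0, r1, r2, vec3_dotProduct, cross_apply] at this
  simp only [Matrix.cons_val] at this
  have h3 : U 0 1 * U 0 2 * (h 2 - h 1) = 0 := by linear_combination this
  exact mul_ne_zero (mul_ne_zero h1 h2)
    (sub_ne_zero.mpr fun h12 => absurd (hd h12) (by decide)) h3

/-- At the distinguished point the second and third columns of the pencil, written in the eigenbasis
`g`, are proportional. -/
theorem isKernelPoint_coord (hg : A * (g : Matrix (Fin 3) (Fin 3) ℂ) = g.val * diagonal h)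
    (hd : Function.Injective h) (h1 : ((g⁻¹).val * B * g.val) 0 1 ≠ 0)
    (h2 : ((g⁻¹).val * B * g.val) 0 2 ≠ 0) :
    IsKernelPoint A B ((g⁻¹).val 0)
      ![coordL h ((g⁻¹).val * B * g.val), coordM h ((g⁻¹).val * B * g.val), 1]
      (g.val *ᵥ ![0, ((g⁻¹).val * B * g.val) 0 2, -((g⁻¹).val * B * g.val) 0 1]) := by
  set U := (g⁻¹).val * B * g.val with hU
  set w : Fin 3 → ℂ := ![0, U 0 2, -U 0 1] with hw
  have hback : (g⁻¹).val *ᵥ (g.val *ᵥ w) = w := by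
    rw [mulVec_mulVec, Units.inv_mul, one_mulVec]
  have hh : h 2 - h 1 ≠ 0 := sub_ne_zero.mpr fun h12 => absurd (hd h12) (by decide)
  refine ⟨?_, congrFun hback 0, ?_, rfl⟩
  · intro h0
    rw [h0, mulVec_zero] at hback
    exact h2 (congrFun hback 1).symm
  · have hBg : B * g.val = g.val * U := by
      rw [hU, ← mul_assoc, ← mul_assoc, Units.mul_inv, one_mul]
    have hN : pencil A B ![coordL h U, coordM h U, 1] * g.val
        = g.val * (coordL h U • 1 + coordM h U • diagonal h + U) := by
      simp only [pencil, Matrix.cons_val, add_mul, mul_add, Matrix.smul_mul, Matrix.mul_smul, hg,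
        hBg, one_mul, mul_one, one_smul]
    rw [mulVec_mulVec, hN, ← mulVec_mulVec]
    have hz : (coordL h U • (1 : Matrix (Fin 3) (Fin 3) ℂ) + coordM h U • diagonal h + U) *ᵥ w
        = 0 := by
      ext i
      rw [add_mulVec, add_mulVec, smul_mulVec, smul_mulVec, one_mulVec]
      simp only [Pi.add_apply, Pi.smul_apply, smul_eq_mul, mulVec, hw,
        vec3_dotProduct, coordL, coordM]
      fin_cases i
      · simp
        ring
      · simp
        field_simp
        ring
      · simp
        field_simp
        ring
    rw [hz, mulVec_zero]

end Frame

/-! ### The transposition of the generators -/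

theorem outAct_transposition (A B : GL (Fin 3) ℂ) :
    outAct transposition (Quotient.mk conjSetoid (A, B)) = Quotient.mk conjSetoid (B, A) := by
  refine congrArg (Quotient.mk conjSetoid) ?_
  simp [autActPair, pairRep]

theorem sigma_transposition :
    ((sigma transposition : GL (Fin 2) ℤ) : Matrix (Fin 2) (Fin 2) ℤ) = !![0, 1; 1, 0] := by
  change exponentMatrix _ = _
  ext i j
  fin_cases i <;> fin_cases j <;> simp [exponentMatrix, exponentSum]

end

theorem proposition1 (A B A' B' : GL (Fin 3) ℂ)
    (hact : (Quotient.mk conjSetoid (A', B') : ModuliM)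
      = outAct transposition (Quotient.mk conjSetoid (A, B)))
    (hsmooth : IsNonsingular (spectralCubic A B))
    (h ξ : Fin 3 → ℂ) (g k : GL (Fin 3) ℂ)
    (hg : IsEigenframe A B h g) (hk : IsEigenframe A' B' ξ k) :
    ((sigma transposition : GL (Fin 2) ℤ) : Matrix (Fin 2) (Fin 2) ℤ) = !![0, 1; 1, 0] ∧
    outAct transposition (Quotient.mk conjSetoid (A, B)) = Quotient.mk conjSetoid (B, A) ∧
    spectralCubic A' B' = swapPoly (spectralCubic A B) ∧
    ∃ (T Y : PlanePt) (l₁ l₂ : Fin 3 → ℂ),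
      IsLineSection (spectralCubic A B) l₁ (pointX (ξ 0)) (distinguishedPoint B h g) T ∧
      (∀ l T', IsLineSection (spectralCubic A B) l (pointX (ξ 0)) (distinguishedPoint B h g) T' →
        T' = T) ∧
      IsLineSection (spectralCubic A B) l₂ (pointP (h 0)) T Y ∧
      (∀ l Y', IsLineSection (spectralCubic A B) l (pointP (h 0)) T Y' → Y' = Y) ∧
      distinguishedPoint B' ξ k = swapPoint Y ∧
      HasDivisor (spectralCubic A B) (X 1 * linForm l₂) (X 2 * linForm l₁)
        (triple (pointX (ξ 1)) (pointX (ξ 2)) Y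
          - triple (pointP (h 1)) (pointP (h 2)) (distinguishedPoint B h g)) ∧
      LinEquivDiv (spectralCubic A B)
        (triple (pointP (h 1)) (pointP (h 2)) (distinguishedPoint B h g))
        (triple (pointX (ξ 1)) (pointX (ξ 2)) Y) := by
  have hF := isHomogeneous_spectralCubic A.val B.val
  rw [outAct_transposition] at hact
  obtain ⟨m, hmA, hmB⟩ := Quotient.exact hact.symm
  dsimp only at hmA hmB
  refine ⟨sigma_transposition, outAct_transposition A B, ?_, ?_⟩
  · rw [← spectralCubic_swap]
    exact spectralCubic_conj m (congrArg Units.val hmA) (congrArg Units.val hmB)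
  -- conjugation by `m` turns the eigenframe of `(A', B')` into one of `(B, A)`
  set k' : GL (Fin 3) ℂ := m⁻¹ * k with hk'
  have hconj : (k⁻¹ * B' * k : GL (Fin 3) ℂ) = k'⁻¹ * A * k' := by
    rw [hk', ← hmB]; group
  have hBk : B.val * k'.val = k'.val * diagonal ξ := by
    have h1 : B * k' = m⁻¹ * (A' * k) := by rw [hk', ← hmA]; group
    have h2 : B.val * k'.val = (m⁻¹).val * (A'.val * k.val) := congrArg Units.val h1
    rw [h2, hk.eigen, ← mul_assoc]
    rfl
  have hu1 : ((k'⁻¹).val * A.val * k'.val) 0 1 ≠ 0 := by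
    have := hk.entry12
    rwa [hconj] at this
  have hu2 : ((k'⁻¹).val * A.val * k'.val) 0 2 ≠ 0 := by
    have := hk.entry13
    rwa [hconj] at this
  have hD : distinguishedPoint B' ξ k = distinguishedPoint A ξ k' := by
    simp only [distinguishedPoint, hconj]
  have hpair : IsEigenpair A.val B.val ((g⁻¹).val 0) ((k'⁻¹).val 0) (h 0) (ξ 0) :=
    ⟨inv_row_vecMul hg.eigen, inv_row_vecMul hBk,
      inv_row_cyclic hg.eigen hg.distinct hg.entry12 hg.entry13,
      inv_row_cyclic hBk hk.distinct hu1 hu2⟩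
  obtain ⟨T, hT, hY⟩ := hpair.exists_line_sections hsmooth.noLine
    (isKernelPoint_coord hg.eigen hg.distinct hg.entry12 hg.entry13)
    (isKernelPoint_coord hBk hk.distinct hu1 hu2)
    (fun h0 => one_ne_zero (congrFun h0 2)) (fun h0 => one_ne_zero (congrFun h0 2))
  change IsLineSection _ _ _ (distinguishedPoint B h g) _ at hT
  change IsLineSection _ _ _ _ (swapPoint (distinguishedPoint A ξ k')) at hY
  have hX' : (X 1 : MvPolynomial (Fin 3) ℂ) = linForm ![0, 1, 0] := by
    simp [linForm, Fin.sum_univ_three]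
  have hX'' : (X 2 : MvPolynomial (Fin 3) ℂ) = linForm ![0, 0, 1] := by
    simp [linForm, Fin.sum_univ_three]
  have hsX := isLineSection_pointX (A := A.val) hBk
  have hsP := isLineSection_pointP (B := B.val) hg.eigen
  have hF0 := spectralCubic_ne_zero A.val B.val
  refine ⟨T, _, _, _, hT, fun l T' hT' => hT.third_unique hF hsmooth hT', hY,
    fun l Y' hY' => hY.third_unique hF hsmooth hY', ?_, ?_, ?_⟩
  · rw [hD, distinguishedPoint, swapPoint_mk, swapPoint_mk]
    simp only [swapVec_swapVec]
  · rw [hX', hX'']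
    convert hasDivisor_of_isLineSection hF hsmooth hF0 hsX hY hsP hT using 1
    simp only [triple]
    abel
  · have hdiv := hasDivisor_of_isLineSection hF hsmooth hF0 hsP hT hsX hY
    refine ⟨_, _, Eq.mp (congrArg (HasDivisor _ _ _) ?_) hdiv⟩
    simp only [triple]
    abel
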